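/- **Theorem (odometers are not separably axiomatizable).** For a sequence $a=(a_n)_{n\ge 1}$ of integers $a_n\ge 2$ let $\sigma_a$ be the homeomorphism "add $1$ to the first digit, with carry to the right" of $X_a=\prod_n\{0,\dots,a_n-1\}$ (product topology). An *odometer* is a dynamical system topologically conjugate to some $(X_a,\sigma_a)$. For a homeomorphism $S$ of a compact Hausdorff space $X$, also write $S$ for the automorphism $f\mapsto f\circ S$ of $C(X)$. Regard commutative unital C*-algebras with an automorphism as metric structures in the language of unital C*-algebras with an additional unary function symbol for the automorphism (continuous logic: atomic formulas are norms of terms, connectives are continuous functions $\mathbb R^k\to\mathbb R$, quantifiers are $\sup$ and $\inf$ over the balls of radius $r\in\mathbb N$; a theory is a set of sentences $\varphi$, each read as the condition $\varphi=0$). 1. The property of being an odometer on the Cantor set is not separably axiomatizable: there is no theory $T$ such that a separable structure $(A,\sigma)$ of the above kind is a model of $T$ if and only if $(A,\sigma)\cong(C(X),S)$ for some odometer $(X,S)$ on a Cantor set $X$. 2. Moreover, for each prime $p$ let $(X_p,\sigma_p)$ be the odometer of the constant sequence $(p,p,p,\dots)$, let $\mathcal U$ be any nonprincipal ultrafilter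 on the set of primes, and let $(A,\sigma)=\prod_{\mathcal U}(C(X_p),\sigma_p)$ be the ultraproduct (bounded families modulo families whose norms tend to $0$ along $\mathcal U$). Then $(A,\sigma)$ has a separable elementary substructure. Every separable elementary substructure $(A_0,\sigma_0)$ of $(A,\sigma)$ is a model of every theory that has all $(C(X_p),\sigma_p)$ as models; and whenever $(A_0,\sigma_0)\cong(C(Y),\tau)$ for a homeomorphism $\tau$ of a compact Hausdorff space $Y$, there are no integers $a_n\ge2$ and partitions $P_0=\{Y\},P_1,P_2,\dots$ of $Y$ into nonempty clopen sets such that, for all $n\ge 1$, every member of $P_{n-1}$ is the union of exactly $a_n$ members of $P_n$, and $\tau$ permutes the $a_1\cdots a_n$ members of $P_n$ in a single cycle. -/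

import Mathlib

open scoped ENNReal Topology

noncomputable section

namespace CStarDyn

/-! ### Continuous logic for unital C⋆-algebras with an automorphism -/

/-- Terms with free variables among `x₀, …, xₙ₋₁`: the `⋆`-polynomials with complex coefficients
that may also involve the unary function symbol for the automorphism. -/
inductive Term (n : ℕ) : Type
  | var (i : Fin n) : Term n
  | zero : Term n
  | one : Term n
  | plus (s t : Term n) : Term n
  | times (s t : Term n) : Term n
  | smul (c : ℂ) (t : Term n) : Term n
  | adj (t : Term n) : Term n
  | aut (t : Term n) : Term n

/-- Formulas of continuous logic with free variables among `x₀, …, xₙ₋₁`.  Atomic formulas are the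
norms of terms, the connectives are all continuous functions `ℝᵏ → ℝ`, and the quantifiers are the
supremum and the infimum over the ball of radius `r`, for the sorts `r = 0, 1, 2, …`. -/
inductive Formula : ℕ → Type
  | normOf {n : ℕ} (t : Term n) : Formula n
  | conn {n k : ℕ} (u : C(Fin k → ℝ, ℝ)) (φ : Fin k → Formula n) : Formula n
  | sup {n : ℕ} (r : ℕ) (φ : Formula (n + 1)) : Formula n
  | inf {n : ℕ} (r : ℕ) (φ : Formula (n + 1)) : Formula n

/-- A sentence is a formula without free variables. -/
abbrev Sentence : Type := Formula 0

/-- A theory is a set of sentences `φ`, each read as the condition `φ = 0`. -/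
abbrev Theory : Type := Set Sentence

section Semantics

variable {A : Type*} [CommCStarAlgebra A] (σ : A ≃⋆ₐ[ℂ] A)

/-- The interpretation of a term in the structure `(A, σ)`. -/
def Term.eval {n : ℕ} (v : Fin n → A) : Term n → A
  | .var i => v i
  | .zero => 0
  | .one => 1
  | .plus s t => s.eval v + t.eval v
  | .times s t => s.eval v * t.eval v
  | .smul c t => c • t.eval v
  | .adj t => star (t.eval v)
  | .aut t => σ (t.eval v)

/-- The value of a formula in the structure `(A, σ)` at an assignment of its free variables.
The newly bound variable is `x₀`; the other ones are shifted by one. -/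
def Formula.eval : {n : ℕ} → Formula n → (Fin n → A) → ℝ
  | _, .normOf t, v => ‖t.eval σ v‖
  | _, .conn u φ, v => u fun i => (φ i).eval v
  | _, .sup r φ, v => ⨆ x : Metric.closedBall (0 : A) r, φ.eval (Fin.cons (x : A) v)
  | _, .inf r φ, v => ⨅ x : Metric.closedBall (0 : A) r, φ.eval (Fin.cons (x : A) v)

/-- `(A, σ)` is a model of the theory `T`. -/
def Models (T : Theory) : Prop := ∀ φ ∈ T, φ.eval σ (Fin.elim0 : Fin 0 → A) = 0

/-- `j` identifies `(A, σ)` with an elementary substructure of `(B, τ)`: all formulas take the same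
values in both structures at tuples from `A`.  (Applied to the atomic formulas this gives that `j`
is isometric and that `j ∘ σ = τ ∘ j`.) -/
def IsElementaryEmbedding {B : Type*} [CommCStarAlgebra B] (τ : B ≃⋆ₐ[ℂ] B) (j : A →⋆ₐ[ℂ] B) :
    Prop :=
  ∀ (n : ℕ) (φ : Formula n) (v : Fin n → A), φ.eval τ (fun i => j (v i)) = φ.eval σ v

/-- `(A, σ)` and `(B, τ)` are isomorphic. -/
def Isomorphic {B : Type*} [CommCStarAlgebra B] (τ : B ≃⋆ₐ[ℂ] B) : Prop :=
  ∃ Φ : A ≃⋆ₐ[ℂ] B, ∀ x, Φ (σ x) = τ (Φ x)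

end Semantics

/-- The automorphism `f ↦ f ∘ S` of `C(X)` induced by a homeomorphism `S` of `X`. -/
def inducedAut {X : Type*} [TopologicalSpace X] [CompactSpace X] (S : X ≃ₜ X) :
    C(X, ℂ) ≃⋆ₐ[ℂ] C(X, ℂ) :=
  S.compStarAlgEquiv' ℂ ℂ

/-- The property `P` of topological dynamical systems is separably axiomatizable for the class `𝒞`
of compact metrizable spaces: there is a theory whose separable models are, up to isomorphism,
exactly the structures `(C(X), S)` with `X` in `𝒞` and `S` satisfying `P`.  The structures that
are considered are the commutative unital C⋆-algebras with an automorphism. (A separable one has at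
most continuum many elements, so those in `Type` are all of them up to isomorphism.) -/
def SeparablyAxiomatizable (𝒞 : ∀ (X : Type) [TopologicalSpace X], Prop)
    (P : ∀ (X : Type) [TopologicalSpace X], (X ≃ₜ X) → Prop) : Prop :=
  ∃ T : Theory, ∀ (A : Type) [CommCStarAlgebra A] [TopologicalSpace.SeparableSpace A]
    (σ : A ≃⋆ₐ[ℂ] A),
    Models σ T ↔
      ∃ (X : Type) (_ : TopologicalSpace X) (_ : CompactSpace X)
        (_ : TopologicalSpace.MetrizableSpace X) (S : X ≃ₜ X),
        𝒞 X ∧ P X S ∧ Isomorphic σ (inducedAut S)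

/-- `X` is a Cantor set. -/
def IsCantorSet (X : Type) [TopologicalSpace X] : Prop := Nonempty (X ≃ₜ (ℕ → Bool))

/-! ### Odometers -/

section Odometer

variable (a : ℕ → ℕ)

/-- Addition of `1` with carry to the right: the `n`-th digit is increased (modulo `a n`) exactly if
all earlier digits are maximal, and is left alone otherwise. -/
def odometerFun (b : ∀ n, Fin (a n)) : ∀ n, Fin (a n) := fun n =>
  open Classical in
  if ∀ i < n, (b i : ℕ) + 1 = a i then ⟨(b n + 1) % a n, Nat.mod_lt _ (b n).pos⟩ else b n

/-- Subtraction of `1` with borrow to the right. -/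
def odometerInv (b : ∀ n, Fin (a n)) : ∀ n, Fin (a n) := fun n =>
  open Classical in
  if ∀ i < n, (b i : ℕ) = 0 then ⟨(b n + (a n - 1)) % a n, Nat.mod_lt _ (b n).pos⟩ else b n

theorem succ_mod_eq_zero_iff {m k : ℕ} (h : k < m) : (k + 1) % m = 0 ↔ k + 1 = m := by
  rcases Nat.lt_or_ge (k + 1) m with h' | h'
  · rw [Nat.mod_eq_of_lt h']; omega
  · have : k + 1 = m := by omega
    simp [this]

theorem pred_mod_succ_eq_iff {m k : ℕ} (h : k < m) : (k + (m - 1)) % m + 1 = m ↔ k = 0 := by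
  rcases Nat.eq_zero_or_pos k with rfl | h'
  · rw [Nat.zero_add, Nat.mod_eq_of_lt (by omega)]; omega
  · have : k + (m - 1) = (k - 1) + m := by omega
    rw [this, Nat.add_mod_right, Nat.mod_eq_of_lt (by omega)]; omega

theorem odometerFun_carry (b : ∀ n, Fin (a n)) (n : ℕ) :
    (∀ i < n, (odometerFun a b i : ℕ) = 0) ↔ ∀ i < n, (b i : ℕ) + 1 = a i := by
  induction n with
  | zero => simp
  | succ n ih =>
    rw [Nat.forall_lt_succ_right, Nat.forall_lt_succ_right, ih]
    refine and_congr_right fun h => ?_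
    rw [odometerFun, if_pos h]
    exact succ_mod_eq_zero_iff (b n).isLt

theorem odometerInv_borrow (b : ∀ n, Fin (a n)) (n : ℕ) :
    (∀ i < n, (odometerInv a b i : ℕ) + 1 = a i) ↔ ∀ i < n, (b i : ℕ) = 0 := by
  induction n with
  | zero => simp
  | succ n ih =>
    rw [Nat.forall_lt_succ_right, Nat.forall_lt_succ_right, ih]
    refine and_congr_right fun h => ?_
    rw [odometerInv, if_pos h]
    exact pred_mod_succ_eq_iff (b n).isLt

theorem odometer_left_inv : Function.LeftInverse (odometerInv a) (odometerFun a) := by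
  intro b
  funext n
  rw [odometerInv]
  by_cases h : ∀ i < n, (b i : ℕ) + 1 = a i
  · rw [if_pos ((odometerFun_carry a b n).2 h)]
    ext
    have hb := (b n).isLt
    simp only [odometerFun, if_pos h]
    have e : (b n : ℕ) + 1 + (a n - 1) = b n + a n := by omega
    rw [Nat.mod_add_mod, e, Nat.add_mod_right, Nat.mod_eq_of_lt hb]
  · rw [if_neg (mt (odometerFun_carry a b n).1 h), odometerFun, if_neg h]

theorem odometer_right_inv : Function.RightInverse (odometerInv a) (odometerFun a) := by
  intro b
  funext n
  rw [odometerFun]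
  by_cases h : ∀ i < n, (b i : ℕ) = 0
  · rw [if_pos ((odometerInv_borrow a b n).2 h)]
    ext
    have hb := (b n).isLt
    simp only [odometerInv, if_pos h]
    have e : (b n : ℕ) + (a n - 1) + 1 = b n + a n := by omega
    rw [Nat.mod_add_mod, e, Nat.add_mod_right, Nat.mod_eq_of_lt hb]
  · rw [if_neg (mt (odometerInv_borrow a b n).1 h), odometerInv, if_neg h]

theorem continuous_of_initial {F : (∀ n, Fin (a n)) → ∀ n, Fin (a n)}
    (hF : ∀ n b c, (∀ i ≤ n, b i = c i) → F b n = F c n) : Continuous F := by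
  refine continuous_pi fun n => continuous_discrete_rng.2 fun k => ?_
  rw [isOpen_iff_mem_nhds]
  intro b hb
  have hn : ∀ᶠ c in 𝓝 b, ∀ i ∈ Set.Iic n, c i = b i := by
    rw [Filter.eventually_all_finite (Set.finite_Iic n)]
    intro i _
    exact (continuous_apply i).continuousAt.eventually
      ((isOpen_discrete {b i}).mem_nhds rfl)
  filter_upwards [hn] with c hc
  simp only [Set.mem_preimage, Set.mem_singleton_iff] at hb ⊢
  rw [← hb]
  exact hF n c b fun i hi => hc i hi

theorem continuous_odometerFun : Continuous (odometerFun a) := by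
  refine continuous_of_initial a fun n b c h => ?_
  have e : (∀ i < n, (b i : ℕ) + 1 = a i) ↔ ∀ i < n, (c i : ℕ) + 1 = a i :=
    forall₂_congr fun i hi => by rw [h i hi.le]
  simp only [odometerFun, e, h n le_rfl]

theorem continuous_odometerInv : Continuous (odometerInv a) := by
  refine continuous_of_initial a fun n b c h => ?_
  have e : (∀ i < n, (b i : ℕ) = 0) ↔ ∀ i < n, (c i : ℕ) = 0 :=
    forall₂_congr fun i hi => by rw [h i hi.le]
  simp only [odometerInv, e, h n le_rfl]

/-- The odometer map of the sequence `a` on `∏ₙ {0, …, a n - 1}` with the product topology. -/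
def odometer : (∀ n, Fin (a n)) ≃ₜ (∀ n, Fin (a n)) where
  toFun := odometerFun a
  invFun := odometerInv a
  left_inv := odometer_left_inv a
  right_inv := odometer_right_inv a
  continuous_toFun := continuous_odometerFun a
  continuous_invFun := continuous_odometerInv a

end Odometer

/-- `(X, S)` is an odometer: it is conjugate to the odometer map of a sequence of integers `≥ 2`. -/
def IsOdometer (X : Type) [TopologicalSpace X] (S : X ≃ₜ X) : Prop :=
  ∃ a : ℕ → ℕ, (∀ n, 2 ≤ a n) ∧
    ∃ h : X ≃ₜ (∀ n, Fin (a n)), ∀ x, h (S x) = odometer a (h x)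

/-- The structure `(C(X_p), σ_p)` of the odometer for the constant sequence `(p, p, p, …)`. -/
def pOdometerAut (p : ℕ) : C(ℕ → Fin p, ℂ) ≃⋆ₐ[ℂ] C(ℕ → Fin p, ℂ) :=
  inducedAut (odometer fun _ => p)

/-- `Y` has a refining sequence of clopen partitions which `τ` permutes in the way in which an
odometer permutes its cylinder sets: `P 0` is the trivial partition, every member of `P n` is the
union of exactly `a n ≥ 2` members of `P (n + 1)`, and `τ` permutes each `P n` in one cycle (of
length `a 0 ⋯ a (n - 1)`). -/
def HasOdometerPartitions {Y : Type*} [TopologicalSpace Y] (τ : Y ≃ₜ Y) : Prop :=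
  ∃ (a : ℕ → ℕ) (P : ℕ → Set (Set Y)),
    (∀ n, 2 ≤ a n) ∧
    P 0 = {Set.univ} ∧
    (∀ n, (P n).ncard = ∏ i ∈ Finset.range n, a i) ∧
    (∀ n, ∀ B ∈ P n, IsClopen B ∧ B.Nonempty) ∧
    (∀ n, (P n).PairwiseDisjoint id) ∧
    (∀ n, ⋃₀ P n = Set.univ) ∧
    (∀ n, ∀ B ∈ P n, {B' ∈ P (n + 1) | B' ⊆ B}.ncard = a n ∧
      ⋃₀ {B' ∈ P (n + 1) | B' ⊆ B} = B) ∧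
    (∀ n, ∀ B ∈ P n, τ '' B ∈ P n) ∧
    (∀ n, ∀ B ∈ P n, ∀ B' ∈ P n, ∃ k : ℕ, (τ^[k]) '' B = B')

/-! ### Ultraproducts -/

section Ultraproduct

variable {ι : Type*} (U : Ultrafilter ι) (A : ι → Type*) [∀ i, CommCStarAlgebra (A i)]
  [∀ i, Nontrivial (A i)]

/-- The ideal of the bounded families whose norms tend to `0` along `U`. -/
def nullIdeal : Ideal (lp A ∞) where
  carrier := {f | Filter.Tendsto (fun i => ‖f i‖) U (𝓝 0)}
  zero_mem' := by simp
  add_mem' {f g} hf hg := by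
    simp only [Set.mem_ofPred_eq] at hf hg ⊢
    refine squeeze_zero (fun i => norm_nonneg _) (fun i => ?_) (by simpa using hf.add hg)
    exact norm_add_le (f i) (g i)
  smul_mem' c f hf := by
    simp only [Set.mem_ofPred_eq] at hf ⊢
    refine squeeze_zero (fun i => norm_nonneg _) (fun i => ?_) (by simpa using hf.const_mul ‖c‖)
    calc ‖(c • f) i‖ = ‖c i * f i‖ := rfl
      _ ≤ ‖c i‖ * ‖f i‖ := norm_mul_le _ _
      _ ≤ ‖c‖ * ‖f i‖ := by gcongr; exact lp.norm_apply_le_norm (by simp) c i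

variable {A}

theorem mem_nullIdeal {f : lp A ∞} :
    f ∈ nullIdeal U A ↔ Filter.Tendsto (fun i => ‖f i‖) U (𝓝 0) := Iff.rfl

theorem mem_nullIdeal_iff {f : lp A ∞} :
    f ∈ nullIdeal U A ↔ ∀ ε > 0, ∀ᶠ i in (U : Filter ι), ‖f i‖ < ε := by
  rw [mem_nullIdeal, Metric.tendsto_nhds]
  simp

instance isClosed_nullIdeal : IsClosed (nullIdeal U A : Set (lp A ∞)) := by
  refine isClosed_of_closure_subset fun f hf => ?_
  rw [SetLike.mem_coe, mem_nullIdeal_iff]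
  intro ε hε
  obtain ⟨g, hg, hfg⟩ := Metric.mem_closure_iff.1 hf (ε / 2) (half_pos hε)
  filter_upwards [(mem_nullIdeal_iff U).1 hg (ε / 2) (half_pos hε)] with i hi
  have h1 : ‖(f - g) i‖ ≤ ‖f - g‖ := lp.norm_apply_le_norm (by simp) (f - g) i
  have h2 : ‖f i‖ ≤ ‖(f - g) i‖ + ‖g i‖ := by
    have : f i = (f - g) i + g i := by simp
    conv_lhs => rw [this]
    exact norm_add_le _ _
  rw [dist_eq_norm] at hfg
  linarith

theorem norm_mk_le {f : lp A ∞} {r : ℝ} (hr : 0 ≤ r) (h : ∀ᶠ i in (U : Filter ι), ‖f i‖ ≤ r) :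
    ‖Ideal.Quotient.mk (nullIdeal U A) f‖ ≤ r := by
  classical
  have hb : ∀ i, ‖(if ‖f i‖ ≤ r then f i else 0)‖ ≤ r := fun i => by
    split_ifs with hi
    · exact hi
    · simpa using hr
  let g : lp A ∞ := ⟨fun i => if ‖f i‖ ≤ r then f i else 0,
    memℓp_infty ⟨r, by rintro _ ⟨i, rfl⟩; exact hb i⟩⟩
  have hg : ‖g‖ ≤ r := lp.norm_le_of_forall_le hr hb
  have e : Ideal.Quotient.mk (nullIdeal U A) f = Ideal.Quotient.mk (nullIdeal U A) g := by
    rw [Ideal.Quotient.eq, mem_nullIdeal_iff]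
    intro ε hε
    filter_upwards [h] with i hi
    have : (f - g) i = 0 := by
      change f i - (if ‖f i‖ ≤ r then f i else 0) = 0
      rw [if_pos hi, sub_self]
    rw [this]
    simpa using hε
  rw [e]
  exact (Ideal.Quotient.norm_mk_le _ g).trans hg

theorem eventually_lt_of_norm_mk_lt {f : lp A ∞} {r : ℝ}
    (h : ‖Ideal.Quotient.mk (nullIdeal U A) f‖ < r) : ∀ᶠ i in (U : Filter ι), ‖f i‖ < r := by
  obtain ⟨g, hg, hgr⟩ := Ideal.Quotient.norm_mk_lt (Ideal.Quotient.mk (nullIdeal U A) f)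
    (half_pos (sub_pos.2 h))
  rw [eq_comm, Ideal.Quotient.eq, mem_nullIdeal_iff] at hg
  filter_upwards [hg _ (half_pos (sub_pos.2 h))] with i hi
  have h1 : ‖g i‖ ≤ ‖g‖ := lp.norm_apply_le_norm (by simp) g i
  have h2 : ‖f i‖ ≤ ‖(f - g) i‖ + ‖g i‖ := by
    have : f i = (f - g) i + g i := by simp
    conv_lhs => rw [this]
    exact norm_add_le _ _
  linarith

variable (A)

/-- The metric ultraproduct of the C⋆-algebras `A i` along `U`: bounded families modulo the families
whose norms tend to `0` along `U`. -/
def Ultraproduct : Type _ := lp A ∞ ⧸ nullIdeal U A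

instance : NormedCommRing (Ultraproduct U A) :=
  inferInstanceAs (NormedCommRing (lp A ∞ ⧸ nullIdeal U A))

instance : NormedAlgebra ℂ (Ultraproduct U A) :=
  inferInstanceAs (NormedAlgebra ℂ (lp A ∞ ⧸ nullIdeal U A))

instance : CompleteSpace (Ultraproduct U A) :=
  inferInstanceAs (CompleteSpace (lp A ∞ ⧸ nullIdeal U A))

/-- The class of a bounded family in the ultraproduct. -/
def Ultraproduct.mk : lp A ∞ →ₐ[ℂ] Ultraproduct U A := Ideal.Quotient.mkₐ ℂ (nullIdeal U A)

variable {A}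

theorem Ultraproduct.mk_surjective : Function.Surjective (Ultraproduct.mk U A) :=
  Ideal.Quotient.mk_surjective

theorem star_mem_nullIdeal {f : lp A ∞} (hf : f ∈ nullIdeal U A) : star f ∈ nullIdeal U A := by
  rw [mem_nullIdeal] at hf ⊢
  simpa using hf

instance : Star (Ultraproduct U A) where
  star := Ideal.quotientMap (nullIdeal U A) (starRingEnd (lp A ∞)) fun _ => star_mem_nullIdeal U

theorem Ultraproduct.star_mk (f : lp A ∞) :
    star (Ultraproduct.mk U A f) = Ultraproduct.mk U A (star f) := rfl

instance : StarRing (Ultraproduct U A) where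
  star_involutive x := by
    obtain ⟨f, rfl⟩ := Ultraproduct.mk_surjective U x
    simp only [Ultraproduct.star_mk, star_star]
  star_mul x y := by
    obtain ⟨f, rfl⟩ := Ultraproduct.mk_surjective U x
    obtain ⟨g, rfl⟩ := Ultraproduct.mk_surjective U y
    simp only [Ultraproduct.star_mk, ← map_mul, star_mul]
  star_add x y := by
    obtain ⟨f, rfl⟩ := Ultraproduct.mk_surjective U x
    obtain ⟨g, rfl⟩ := Ultraproduct.mk_surjective U y
    simp only [Ultraproduct.star_mk, ← map_add, star_add]

instance : StarModule ℂ (Ultraproduct U A) where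
  star_smul c x := by
    obtain ⟨f, rfl⟩ := Ultraproduct.mk_surjective U x
    simp only [Ultraproduct.star_mk, ← map_smul, star_smul]

instance : CStarRing (Ultraproduct U A) where
  norm_mul_self_le x := by
    obtain ⟨f, rfl⟩ := Ultraproduct.mk_surjective U x
    refine le_of_forall_gt fun r hr => ?_
    obtain ⟨s, hs, hsr⟩ := exists_between hr
    have hs0 : 0 ≤ s := (norm_nonneg _).trans hs.le
    rw [Ultraproduct.star_mk, ← map_mul] at hs
    have h := eventually_lt_of_norm_mk_lt U hs
    have h' : ‖Ultraproduct.mk U A f‖ ≤ √s := by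
      refine norm_mk_le U (Real.sqrt_nonneg s) ?_
      filter_upwards [h] with i hi
      have hi' : ‖star (f i) * f i‖ < s := hi
      rw [CStarRing.norm_star_mul_self] at hi'
      exact Real.le_sqrt_of_sq_le (by nlinarith)
    calc ‖Ultraproduct.mk U A f‖ * ‖Ultraproduct.mk U A f‖ ≤ √s * √s := by gcongr
      _ = s := Real.mul_self_sqrt hs0
      _ < r := hsr

instance : CommCStarAlgebra (Ultraproduct U A) where

/-- The coordinatewise action of automorphisms on bounded families. -/
def familyMap (σ : ∀ i, A i ≃⋆ₐ[ℂ] A i) : lp A ∞ →+* lp A ∞ where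
  toFun f := ⟨fun i => σ i (f i), memℓp_infty ⟨‖f‖, by
    rintro _ ⟨i, rfl⟩
    simpa only [StarAlgEquiv.norm_map] using lp.norm_apply_le_norm (by simp) f i⟩⟩
  map_one' := by ext i; exact map_one (σ i)
  map_zero' := by ext i; exact map_zero (σ i)
  map_mul' f g := by ext i; exact map_mul (σ i) (f i) (g i)
  map_add' f g := by ext i; exact map_add (σ i) (f i) (g i)

theorem familyMap_apply (σ : ∀ i, A i ≃⋆ₐ[ℂ] A i) (f : lp A ∞) (i : ι) :
    familyMap σ f i = σ i (f i) := rfl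

theorem familyMap_mem (σ : ∀ i, A i ≃⋆ₐ[ℂ] A i) {f : lp A ∞} (hf : f ∈ nullIdeal U A) :
    familyMap σ f ∈ nullIdeal U A := by
  rw [mem_nullIdeal] at hf ⊢
  simpa only [familyMap_apply, StarAlgEquiv.norm_map] using hf

/-- The map induced on the ultraproduct by a family of automorphisms. -/
def ultraMap (σ : ∀ i, A i ≃⋆ₐ[ℂ] A i) : Ultraproduct U A →+* Ultraproduct U A :=
  Ideal.quotientMap (nullIdeal U A) (familyMap σ) fun _ => familyMap_mem U σ

theorem ultraMap_mk (σ : ∀ i, A i ≃⋆ₐ[ℂ] A i) (f : lp A ∞) :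
    ultraMap U σ (Ultraproduct.mk U A f) = Ultraproduct.mk U A (familyMap σ f) := rfl

/-- The automorphism `[(fᵢ)] ↦ [(σᵢ(fᵢ))]` of the ultraproduct. -/
def ultraAut (σ : ∀ i, A i ≃⋆ₐ[ℂ] A i) : Ultraproduct U A ≃⋆ₐ[ℂ] Ultraproduct U A where
  toFun := ultraMap U σ
  invFun := ultraMap U fun i => (σ i).symm
  left_inv x := by
    obtain ⟨f, rfl⟩ := Ultraproduct.mk_surjective U x
    rw [ultraMap_mk, ultraMap_mk]
    congr 1
    ext i
    exact (σ i).symm_apply_apply (f i)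
  right_inv x := by
    obtain ⟨f, rfl⟩ := Ultraproduct.mk_surjective U x
    rw [ultraMap_mk, ultraMap_mk]
    congr 1
    ext i
    exact (σ i).apply_symm_apply (f i)
  map_mul' := map_mul _
  map_add' := map_add _
  map_star' x := by
    obtain ⟨f, rfl⟩ := Ultraproduct.mk_surjective U x
    rw [Ultraproduct.star_mk, ultraMap_mk, ultraMap_mk, Ultraproduct.star_mk]
    congr 1
    ext i
    exact map_star (σ i) (f i)
  map_smul' c x := by
    obtain ⟨f, rfl⟩ := Ultraproduct.mk_surjective U x
    rw [← map_smul, ultraMap_mk, ultraMap_mk, ← map_smul]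
    congr 1
    ext i
    exact map_smul (σ i) c (f i)

end Ultraproduct

instance (p : Nat.Primes) : Nonempty (ℕ → Fin (p : ℕ)) := ⟨fun _ => ⟨0, p.2.pos⟩⟩

/-- The automorphism of the ultraproduct `∏_U C(X_p)` over the primes `p` of the structures of the
`p`-adic odometers. -/
def primeUltraAut (U : Ultrafilter Nat.Primes) :
    Ultraproduct U (fun p : Nat.Primes => C(ℕ → Fin (p : ℕ), ℂ)) ≃⋆ₐ[ℂ]
      Ultraproduct U (fun p : Nat.Primes => C(ℕ → Fin (p : ℕ), ℂ)) :=
  ultraAut U fun p => pOdometerAut p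

end CStarDyn

end

noncomputable section

namespace CStarDyn

/-! The structures `(C(X_p), σ_p)` satisfy a common theory, but their ultraproduct over the primes
has no finite cyclic factor of length at least two. By Łoś's theorem (`Formula.tendsto_eval`) the
ultraproduct is a model of every theory shared by its factors, and by downward Löwenheim–Skolem
(`exists_separable_elementary_substructure`) so are separable elementary substructures of it, and
there are such. It remains to see that none of these comes from an odometer.

The first level of an odometer partition gives an idempotent `f` with `f + σ f + ⋯ + σ^(a-1) f = 1`
for some `a ≥ 2` (`HasOdometerPartitions.exists_idempotent`). These are algebraic identities, so
they pass to the ultraproduct, and there they say that they hold approximately in `C(X_p)` for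
`U`-almost all `p`. As `U` is nonprincipal, some such `p` is prime to `a`.

That is impossible (`pOdometer_not_approx_partition`). The values of an approximate solution along
an orbit are close to an `a`-periodic sequence of zeros and ones with a single one in each window of
length `a`. But the times `p^(φ(a) n)` are congruent to `1` modulo `a`, while the iterates of the
`p`-adic odometer at these times tend to the identity. So the sequence is invariant under a shift by
one, hence constant, and a constant sequence cannot have exactly one `1` in a window of length `a ≥
2`. -/

theorem norm_cons_le {A : Type*} [SeminormedAddCommGroup A] {n : ℕ} {v : Fin n → A} {x : A}
    {R r : ℝ} (hx : ‖x‖ ≤ r) (hv : ‖v‖ ≤ R) :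
    ‖(Fin.cons x v : Fin (n + 1) → A)‖ ≤ max R r := by
  rw [pi_norm_le_iff_of_nonneg (((norm_nonneg _).trans hv).trans (le_max_left _ _))]
  refine Fin.cases ?_ fun i => ?_
  · simpa using Or.inr hx
  · simpa using Or.inl ((norm_le_pi_norm v i).trans hv)

theorem norm_cons_sub_cons {A : Type*} [SeminormedAddCommGroup A] {n : ℕ} {v w : Fin n → A}
    {x : A} {δ : ℝ} (h : ‖v - w‖ ≤ δ) :
    ‖(Fin.cons x v : Fin (n + 1) → A) - Fin.cons x w‖ ≤ δ := by
  have hδ := (norm_nonneg _).trans h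
  rw [pi_norm_le_iff_of_nonneg hδ]
  refine Fin.cases ?_ fun i => ?_
  · simpa using hδ
  · simpa using (norm_le_pi_norm (v - w) i).trans h

instance {A : Type*} [SeminormedAddCommGroup A] (r : ℕ) :
    Nonempty (Metric.closedBall (0 : A) r) := ⟨⟨0, by simp⟩⟩

theorem norm_le_of_mem_ball {A : Type*} [SeminormedAddCommGroup A] {r : ℕ}
    (x : Metric.closedBall (0 : A) r) : ‖(x : A)‖ ≤ r := mem_closedBall_zero_iff.1 x.2

/-- On a ball, a term is bounded by a constant that does not depend on the structure. -/
theorem Term.exists_bound {n : ℕ} (t : Term n) {R : ℝ} (hR : 0 ≤ R) :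
    ∃ M, 0 ≤ M ∧ ∀ {A : Type} [CommCStarAlgebra A] (σ : A ≃⋆ₐ[ℂ] A) (v : Fin n → A),
      ‖v‖ ≤ R → ‖t.eval σ v‖ ≤ M := by
  induction t with
  | var i => exact ⟨R, hR, fun σ v hv => (norm_le_pi_norm v i).trans hv⟩
  | zero => exact ⟨0, le_rfl, fun σ v hv => by simp [Term.eval]⟩
  | one =>
    refine ⟨1, zero_le_one, fun {A} _ σ v hv => ?_⟩
    -- The zero algebra is allowed as a structure, and there `‖1‖ = 0`.
    rcases subsingleton_or_nontrivial A with h | h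
    · rw [Subsingleton.elim (Term.eval σ v Term.one) 0]; simp
    · simp [Term.eval]
  | plus s t hs ht =>
    obtain ⟨M, hM, h⟩ := hs
    obtain ⟨N, hN, k⟩ := ht
    exact ⟨M + N, by positivity, fun σ v hv => norm_add_le_of_le (h σ v hv) (k σ v hv)⟩
  | times s t hs ht =>
    obtain ⟨M, hM, h⟩ := hs
    obtain ⟨N, hN, k⟩ := ht
    exact ⟨M * N, by positivity, fun σ v hv => norm_mul_le_of_le (h σ v hv) (k σ v hv)⟩
  | smul c t ht =>
    obtain ⟨N, hN, k⟩ := ht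
    refine ⟨‖c‖ * N, by positivity, fun σ v hv => ?_⟩
    rw [Term.eval, norm_smul]
    gcongr
    exact k σ v hv
  | adj t ht =>
    obtain ⟨N, hN, k⟩ := ht
    refine ⟨N, by positivity, fun σ v hv => ?_⟩
    rw [Term.eval, norm_star]
    exact k σ v hv
  | aut t ht =>
    obtain ⟨N, hN, k⟩ := ht
    refine ⟨N, by positivity, fun σ v hv => ?_⟩
    rw [Term.eval, StarAlgEquiv.norm_map]
    exact k σ v hv

theorem norm_le_of_forall_abs_le {k : ℕ} {M : Fin k → ℝ} {x : Fin k → ℝ} (h : ∀ i, |x i| ≤ M i) :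
    ‖x‖ ≤ ‖M‖ :=
  (pi_norm_le_iff_of_nonneg (norm_nonneg _)).2 fun i =>
    (h i).trans ((le_abs_self _).trans (norm_le_pi_norm M i))

theorem abs_ciSup_le {ι : Type*} [Nonempty ι] {f : ι → ℝ} {M : ℝ} (h : ∀ i, |f i| ≤ M) :
    |⨆ i, f i| ≤ M := by
  have hb : BddAbove (Set.range f) := ⟨M, by rintro _ ⟨i, rfl⟩; exact (abs_le.1 (h i)).2⟩
  obtain ⟨i⟩ := ‹Nonempty ι›
  exact abs_le.2 ⟨(abs_le.1 (h i)).1.trans (le_ciSup hb i), ciSup_le fun j => (abs_le.1 (h j)).2⟩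

theorem abs_ciInf_le {ι : Type*} [Nonempty ι] {f : ι → ℝ} {M : ℝ} (h : ∀ i, |f i| ≤ M) :
    |⨅ i, f i| ≤ M := by
  have hb : BddBelow (Set.range f) := ⟨-M, by rintro _ ⟨i, rfl⟩; exact (abs_le.1 (h i)).1⟩
  obtain ⟨i⟩ := ‹Nonempty ι›
  exact abs_le.2 ⟨le_ciInf fun j => (abs_le.1 (h j)).1, (ciInf_le hb i).trans (abs_le.1 (h i)).2⟩

theorem exists_bound_comp {k : ℕ} (u : C(Fin k → ℝ, ℝ)) (R : ℝ) :
    ∃ M, 0 ≤ M ∧ ∀ x, ‖x‖ ≤ R → |u x| ≤ M := by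
  obtain ⟨M, hM⟩ := (isCompact_closedBall (0 : Fin k → ℝ) R).exists_bound_of_continuousOn
    u.continuous.continuousOn
  exact ⟨max M 0, le_max_right _ _, fun x hx =>
    (hM x (mem_closedBall_zero_iff.2 hx)).trans (le_max_left _ _)⟩

/-- On a ball, a formula is bounded by a constant that does not depend on the structure. -/
theorem Formula.exists_bound {n : ℕ} (φ : Formula n) {R : ℝ} (hR : 0 ≤ R) :
    ∃ M, 0 ≤ M ∧ ∀ {A : Type} [CommCStarAlgebra A] (σ : A ≃⋆ₐ[ℂ] A) (v : Fin n → A),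
      ‖v‖ ≤ R → |φ.eval σ v| ≤ M := by
  induction φ generalizing R with
  | normOf t =>
    obtain ⟨M, hM, h⟩ := t.exists_bound hR
    exact ⟨M, hM, fun σ v hv => by simpa [Formula.eval] using h σ v hv⟩
  | conn u φ ih =>
    choose M hM h using fun i => ih i hR
    obtain ⟨N, hN, k⟩ := exists_bound_comp u ‖M‖
    exact ⟨N, hN, fun σ v hv => k _ (norm_le_of_forall_abs_le fun i => h i σ v hv)⟩
  | sup r φ ih =>
    obtain ⟨M, hM, h⟩ := ih (hR.trans (le_max_left R r))
    exact ⟨M, hM, fun σ v hv => abs_ciSup_le fun x =>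
      h σ _ (norm_cons_le (norm_le_of_mem_ball x) hv)⟩
  | inf r φ ih =>
    obtain ⟨M, hM, h⟩ := ih (hR.trans (le_max_left R r))
    exact ⟨M, hM, fun σ v hv => abs_ciInf_le fun x =>
      h σ _ (norm_cons_le (norm_le_of_mem_ball x) hv)⟩

/-! ### Quantifiers as suprema and infima of bounded functions -/

section Quantifiers

variable {A : Type} [CommCStarAlgebra A] (σ : A ≃⋆ₐ[ℂ] A) {n : ℕ} (φ : Formula (n + 1)) (r : ℕ)
  (v : Fin n → A)

/-- An unbounded real `⨆` has the default value `0`; boundedness makes the quantifier a genuine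
supremum. -/
theorem Formula.bddAbove :
    BddAbove (Set.range fun x : Metric.closedBall (0 : A) r => φ.eval σ (Fin.cons (x : A) v)) := by
  obtain ⟨M, -, h⟩ := φ.exists_bound ((norm_nonneg v).trans (le_max_left _ (r : ℝ)))
  exact ⟨M, by
    rintro _ ⟨x, rfl⟩
    exact (abs_le.1 (h σ _ (norm_cons_le (norm_le_of_mem_ball x) le_rfl))).2⟩

theorem Formula.bddBelow :
    BddBelow (Set.range fun x : Metric.closedBall (0 : A) r => φ.eval σ (Fin.cons (x : A) v)) := by
  obtain ⟨M, -, h⟩ := φ.exists_bound ((norm_nonneg v).trans (le_max_left _ (r : ℝ)))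
  exact ⟨-M, by
    rintro _ ⟨x, rfl⟩
    exact (abs_le.1 (h σ _ (norm_cons_le (norm_le_of_mem_ball x) le_rfl))).1⟩

variable {φ r v} in
theorem Formula.le_eval_sup {x : A} (hx : ‖x‖ ≤ r) :
    φ.eval σ (Fin.cons x v) ≤ (Formula.sup r φ).eval σ v :=
  le_ciSup (φ.bddAbove σ r v) ⟨x, mem_closedBall_zero_iff.2 hx⟩

variable {φ r v} in
theorem Formula.eval_inf_le {x : A} (hx : ‖x‖ ≤ r) :
    (Formula.inf r φ).eval σ v ≤ φ.eval σ (Fin.cons x v) :=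
  ciInf_le (φ.bddBelow σ r v) ⟨x, mem_closedBall_zero_iff.2 hx⟩

variable {φ r v} in
theorem Formula.eval_sup_le {c : ℝ} (h : ∀ x : A, ‖x‖ ≤ r → φ.eval σ (Fin.cons x v) ≤ c) :
    (Formula.sup r φ).eval σ v ≤ c :=
  ciSup_le fun x => h x (norm_le_of_mem_ball x)

variable {φ r v} in
theorem Formula.le_eval_inf {c : ℝ} (h : ∀ x : A, ‖x‖ ≤ r → c ≤ φ.eval σ (Fin.cons x v)) :
    c ≤ (Formula.inf r φ).eval σ v :=
  le_ciInf fun x => h x (norm_le_of_mem_ball x)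

theorem Formula.exists_lt_eval {ε : ℝ} (hε : 0 < ε) :
    ∃ x : A, ‖x‖ ≤ r ∧ (Formula.sup r φ).eval σ v - ε < φ.eval σ (Fin.cons x v) := by
  obtain ⟨x, hx⟩ := exists_lt_of_lt_ciSup (sub_lt_self ((Formula.sup r φ).eval σ v) hε)
  exact ⟨x, norm_le_of_mem_ball x, hx⟩

theorem Formula.exists_eval_lt {ε : ℝ} (hε : 0 < ε) :
    ∃ x : A, ‖x‖ ≤ r ∧ φ.eval σ (Fin.cons x v) < (Formula.inf r φ).eval σ v + ε := by
  obtain ⟨x, hx⟩ := exists_lt_of_ciInf_lt (lt_add_of_pos_right ((Formula.inf r φ).eval σ v) hε)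
  exact ⟨x, norm_le_of_mem_ball x, hx⟩

end Quantifiers

/-! ### Countable dense families of terms and formulas -/

/-- The terms of depth at most `m` with coefficients in a countable dense set. -/
def denseTerms (n : ℕ) : ℕ → Set (Term n)
  | 0 => Set.range Term.var ∪ {Term.zero, Term.one}
  | m + 1 => denseTerms n m ∪ Set.image2 Term.plus (denseTerms n m) (denseTerms n m) ∪
      Set.image2 Term.times (denseTerms n m) (denseTerms n m) ∪
      Set.image2 Term.smul (Set.range (TopologicalSpace.denseSeq ℂ)) (denseTerms n m) ∪
      Term.adj '' denseTerms n m ∪ Term.aut '' denseTerms n m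

theorem countable_denseTerms (n m : ℕ) : (denseTerms n m).Countable := by
  induction m with
  | zero => exact (Set.countable_range _).union (by simp)
  | succ m ih =>
    exact ((((ih.union (ih.image2 ih _)).union (ih.image2 ih _)).union
      ((Set.countable_range _).image2 ih _)).union (ih.image _)).union (ih.image _)

theorem monotone_denseTerms (n : ℕ) : Monotone (denseTerms n) := by
  refine monotone_nat_of_le_succ fun m t ht => ?_
  simp only [denseTerms, Set.mem_union]
  tauto

/-- The formulas of depth at most `m` with terms and connectives in countable dense sets. -/
def denseFormulas : ℕ → ∀ n, Set (Formula n)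
  | 0, n => Formula.normOf '' ⋃ m, denseTerms n m
  | m + 1, n => denseFormulas m n ∪
      (⋃ k : ℕ, Set.image2 Formula.conn (Set.range (TopologicalSpace.denseSeq C(Fin k → ℝ, ℝ)))
        {φ | ∀ i, φ i ∈ denseFormulas m n}) ∪
      (⋃ r : ℕ, Formula.sup r '' denseFormulas m (n + 1)) ∪
      ⋃ r : ℕ, Formula.inf r '' denseFormulas m (n + 1)

theorem countable_denseFormulas (m n : ℕ) : (denseFormulas m n).Countable := by
  induction m generalizing n with
  | zero => exact (Set.countable_iUnion (countable_denseTerms n)).image _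
  | succ m ih =>
    exact (((ih n).union (Set.countable_iUnion fun k => (Set.countable_range _).image2
      (Set.countable_pi fun _ => ih n) _)).union
      (Set.countable_iUnion fun r => (ih _).image _)).union
      (Set.countable_iUnion fun r => (ih _).image _)

theorem monotone_denseFormulas (n : ℕ) : Monotone fun m => denseFormulas m n := by
  refine monotone_nat_of_le_succ fun m t ht => ?_
  simp only [denseFormulas, Set.mem_union]
  tauto

/-! ### Uniform continuity and approximation by the countable families -/

section Approximation

variable {A : Type} [CommCStarAlgebra A] (σ : A ≃⋆ₐ[ℂ] A)

/-- Approximation of a term by a term of the countable dense family, together with uniform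
continuity on balls. -/
theorem Term.exists_approx {n : ℕ} (t : Term n) {R ε : ℝ} (hR : 0 ≤ R) (hε : 0 < ε) :
    ∃ m, ∃ t' ∈ denseTerms n m, ∃ δ > 0, ∀ v w : Fin n → A, ‖v‖ ≤ R → ‖w‖ ≤ R → ‖v - w‖ ≤ δ →
      ‖t.eval σ v - t'.eval σ w‖ ≤ ε := by
  induction t generalizing ε with
  | var i =>
    exact ⟨0, _, .inl ⟨i, rfl⟩, ε, hε, fun v w _ _ h => (norm_le_pi_norm (v - w) i).trans h⟩
  | zero => exact ⟨0, _, .inr (.inl rfl), 1, one_pos, by simp [Term.eval, hε.le]⟩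
  | one => exact ⟨0, _, .inr (.inr rfl), 1, one_pos, by simp [Term.eval, hε.le]⟩
  | plus s t hs ht =>
    obtain ⟨m, s', hs', δ, hδ, h⟩ := hs (half_pos hε)
    obtain ⟨l, t', ht', δ', hδ', k⟩ := ht (half_pos hε)
    refine ⟨max m l + 1, .plus s' t', .inl (.inl (.inl (.inl (.inr
      ⟨s', monotone_denseTerms n (le_max_left _ _) hs', t',
        monotone_denseTerms n (le_max_right _ _) ht', rfl⟩)))), min δ δ', lt_min hδ hδ',
      fun v w hv hw hvw => ?_⟩
    have h1 := h v w hv hw (hvw.trans (min_le_left _ _))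
    have h2 := k v w hv hw (hvw.trans (min_le_right _ _))
    calc ‖(s.eval σ v + t.eval σ v) - (s'.eval σ w + t'.eval σ w)‖
        = ‖(s.eval σ v - s'.eval σ w) + (t.eval σ v - t'.eval σ w)‖ := by congr 1; abel
      _ ≤ ε / 2 + ε / 2 := norm_add_le_of_le h1 h2
      _ = ε := add_halves ε
  | times s t hs ht =>
    obtain ⟨M, hM, bs⟩ := s.exists_bound hR
    obtain ⟨N, hN, bt⟩ := t.exists_bound hR
    -- The `1` keeps the approximating second factor below `N + 1`; the other bound makes the two
    -- product errors add up to `ε`.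
    have hη : 0 < min 1 (ε / (M + (N + 1))) := lt_min one_pos (by positivity)
    obtain ⟨m, s', hs', δ, hδ, h⟩ := hs hη
    obtain ⟨l, t', ht', δ', hδ', k⟩ := ht hη
    refine ⟨max m l + 1, .times s' t', .inl (.inl (.inl (.inr
      ⟨s', monotone_denseTerms n (le_max_left _ _) hs', t',
        monotone_denseTerms n (le_max_right _ _) ht', rfl⟩))), min δ δ', lt_min hδ hδ',
      fun v w hv hw hvw => ?_⟩
    have h1 := h v w hv hw (hvw.trans (min_le_left _ _))
    have h2 := k v w hv hw (hvw.trans (min_le_right _ _))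
    have b2 : ‖t'.eval σ w‖ ≤ N + 1 := by
      have := norm_sub_norm_le (t'.eval σ w) (t.eval σ v)
      rw [norm_sub_rev] at this
      linarith [bt σ v hv, h2.trans (min_le_left _ _)]
    calc ‖s.eval σ v * t.eval σ v - s'.eval σ w * t'.eval σ w‖
        = ‖s.eval σ v * (t.eval σ v - t'.eval σ w) + (s.eval σ v - s'.eval σ w) * t'.eval σ w‖ := by
          congr 1; ring
      _ ≤ M * (ε / (M + (N + 1))) + (ε / (M + (N + 1))) * (N + 1) :=
          norm_add_le_of_le (norm_mul_le_of_le (bs σ v hv) (h2.trans (min_le_right _ _)))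
            (norm_mul_le_of_le (h1.trans (min_le_right _ _)) b2)
      _ = ε := by field_simp
  | smul c t ht =>
    obtain ⟨N, hN, bt⟩ := t.exists_bound hR
    -- Half of `ε` goes to the coefficient and half to the term. The `1` in the minimum bounds the
    -- new coefficient by `‖c‖ + 1`; `N + 1` avoids a zero denominator.
    obtain ⟨i, hi⟩ := (TopologicalSpace.denseRange_denseSeq ℂ).exists_dist_lt c
      (show 0 < min 1 (ε / (2 * (N + 1))) from lt_min one_pos (by positivity))
    set d := TopologicalSpace.denseSeq ℂ i
    rw [dist_eq_norm] at hi
    have hd : ‖d‖ ≤ ‖c‖ + 1 := by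
      have := norm_sub_norm_le d c
      rw [norm_sub_rev] at this
      linarith [hi.trans_le (min_le_left _ _)]
    obtain ⟨m, t', ht', δ, hδ, k⟩ := ht (show 0 < ε / (2 * (‖c‖ + 1)) by positivity)
    refine ⟨m + 1, .smul d t', .inl (.inl (.inr ⟨d, ⟨i, rfl⟩, t', ht', rfl⟩)), δ, hδ,
      fun v w hv hw hvw => ?_⟩
    have h1 := k v w hv hw hvw
    have h2 := bt σ v hv
    calc ‖c • t.eval σ v - d • t'.eval σ w‖
        = ‖(c - d) • t.eval σ v + d • (t.eval σ v - t'.eval σ w)‖ := by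
          congr 1; module
      _ ≤ ε / (2 * (N + 1)) * (N + 1) + (‖c‖ + 1) * (ε / (2 * (‖c‖ + 1))) := by
          refine norm_add_le_of_le ?_ ?_ <;> rw [norm_smul]
          · gcongr
            · exact hi.le.trans (min_le_right _ _)
            · linarith
          · gcongr
      _ = ε := by field_simp; norm_num
  | adj t ht =>
    obtain ⟨m, t', ht', δ, hδ, k⟩ := ht hε
    refine ⟨m + 1, .adj t', .inl (.inr ⟨t', ht', rfl⟩), δ, hδ, fun v w hv hw hvw => ?_⟩
    rw [Term.eval, Term.eval, ← star_sub, norm_star]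
    exact k v w hv hw hvw
  | aut t ht =>
    obtain ⟨m, t', ht', δ, hδ, k⟩ := ht hε
    refine ⟨m + 1, .aut t', .inr ⟨t', ht', rfl⟩, δ, hδ, fun v w hv hw hvw => ?_⟩
    rw [Term.eval, Term.eval, ← map_sub, StarAlgEquiv.norm_map]
    exact k v w hv hw hvw

/-- Closeness in the compact-open topology is uniform closeness on the ball. One half of the error
is the modulus of continuity of `u`, the other the distance from `u` to a member of the dense
sequence. -/
theorem exists_approx_comp {k : ℕ} (u : C(Fin k → ℝ, ℝ)) (R : ℝ) {ε : ℝ} (hε : 0 < ε) :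
    ∃ i, ∃ η > 0, ∀ x y : Fin k → ℝ, ‖x‖ ≤ R → ‖y‖ ≤ R → ‖x - y‖ ≤ η →
      |u x - TopologicalSpace.denseSeq C(Fin k → ℝ, ℝ) i y| ≤ ε := by
  have hK := isCompact_closedBall (0 : Fin k → ℝ) R
  have hu : {u' : C(Fin k → ℝ, ℝ) | ∀ x ∈ Metric.closedBall 0 R, dist (u x) (u' x) < ε / 2} ∈
      𝓝 u := by
    have := ContinuousMap.tendsto_iff_forall_isCompact_tendstoUniformlyOn.1
      (Filter.tendsto_id (x := 𝓝 u)) _ hK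
    exact Metric.tendstoUniformlyOn_iff.1 this _ (half_pos hε)
  obtain ⟨_, ⟨i, rfl⟩, hu'⟩ :=
    (TopologicalSpace.denseRange_denseSeq C(Fin k → ℝ, ℝ)).inter_nhds_nonempty hu
  obtain ⟨η, hη, h⟩ := Metric.uniformContinuousOn_iff_le.1
    (hK.uniformContinuousOn_of_continuous u.continuous.continuousOn) _ (half_pos hε)
  refine ⟨i, η, hη, fun x y hx hy hxy => ?_⟩
  rw [← mem_closedBall_zero_iff] at hx hy
  have h1 := h x hx y hy (by rwa [dist_eq_norm])
  have h2 := hu' y hy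
  rw [← Real.dist_eq]
  linarith [dist_triangle (u x) (u y) (TopologicalSpace.denseSeq C(Fin k → ℝ, ℝ) i y)]

/-- Approximation of a formula by a formula of the countable dense family, together with uniform
continuity on balls. -/
theorem Formula.exists_approx {n : ℕ} (φ : Formula n) {R ε : ℝ} (hR : 0 ≤ R) (hε : 0 < ε) :
    ∃ m, ∃ ψ ∈ denseFormulas m n, ∃ δ > 0, ∀ v w : Fin n → A, ‖v‖ ≤ R → ‖w‖ ≤ R → ‖v - w‖ ≤ δ →
      |φ.eval σ v - ψ.eval σ w| ≤ ε := by
  induction φ generalizing R ε with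
  | normOf t =>
    obtain ⟨m, t', ht', δ, hδ, h⟩ := t.exists_approx σ hR hε
    exact ⟨0, _, ⟨t', Set.mem_iUnion.2 ⟨m, ht'⟩, rfl⟩, δ, hδ, fun v w hv hw hvw =>
      (abs_norm_sub_norm_le _ _).trans (h v w hv hw hvw)⟩
  | @conn n k u φ ih =>
    choose M hM b using fun i => (φ i).exists_bound hR
    -- The extra `1` leaves room for the values of the approximating formulas, which are taken
    -- within `min 1 η` of the original ones.
    obtain ⟨i, η, hη, hu⟩ := exists_approx_comp u ‖fun i => M i + 1‖ hε
    choose m ψ hψ δ hδ h using fun j => ih j hR (lt_min one_pos hη)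
    obtain ⟨δ', hδ', hle⟩ : ∃ δ' > 0, ∀ j, δ' ≤ δ j := by
      rcases isEmpty_or_nonempty (Fin k) with hk | hk
      · exact ⟨1, one_pos, fun j => isEmptyElim j⟩
      · obtain ⟨j, hj⟩ := Finite.exists_min δ
        exact ⟨δ j, hδ j, hj⟩
    obtain ⟨l, hl⟩ : ∃ l, ∀ j, m j ≤ l :=
      ⟨Finset.univ.sup m, fun j => Finset.le_sup (Finset.mem_univ j)⟩
    refine ⟨l + 1, .conn (TopologicalSpace.denseSeq C(Fin k → ℝ, ℝ) i) ψ,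
      .inl (.inl (.inr (Set.mem_iUnion.2 ⟨k, _, ⟨i, rfl⟩, ψ,
        fun j => monotone_denseFormulas n (hl j) (hψ j), rfl⟩))), δ', hδ',
      fun v w hv hw hvw => ?_⟩
    have key := fun j => h j v w hv hw (hvw.trans (hle j))
    refine hu _ _ (norm_le_of_forall_abs_le fun j => ?_) (norm_le_of_forall_abs_le fun j => ?_) ?_
    · linarith [b j σ v hv]
    · have h1 := (key j).trans (min_le_left _ _)
      have h2 := b j σ v hv
      rw [abs_le] at h1 h2 ⊢
      constructor <;> linarith
    · exact (pi_norm_le_iff_of_nonneg hη.le).2 fun j => (key j).trans (min_le_right _ _)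
  | @sup n r φ ih =>
    obtain ⟨m, ψ, hψ, δ, hδ, h⟩ := ih (hR.trans (le_max_left R r)) hε
    refine ⟨m + 1, .sup r ψ, .inl (.inr (Set.mem_iUnion.2 ⟨r, ψ, hψ, rfl⟩)), δ, hδ,
      fun v w hv hw hvw => ?_⟩
    -- The same `x` occurs on both sides, so the estimate is uniform in the bound variable and
    -- survives the supremum.
    have key : ∀ x : A, ‖x‖ ≤ r → |φ.eval σ (Fin.cons x v) - ψ.eval σ (Fin.cons x w)| ≤ ε :=
      fun x hx => h _ _ (norm_cons_le hx hv) (norm_cons_le hx hw) (norm_cons_sub_cons hvw)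
    have h1 : (Formula.sup r φ).eval σ v ≤ (Formula.sup r ψ).eval σ w + ε :=
      Formula.eval_sup_le σ fun x hx => by
        linarith [(abs_le.1 (key x hx)).2, ψ.le_eval_sup (v := w) σ hx]
    have h2 : (Formula.sup r ψ).eval σ w ≤ (Formula.sup r φ).eval σ v + ε :=
      Formula.eval_sup_le σ fun x hx => by
        linarith [(abs_le.1 (key x hx)).1, φ.le_eval_sup (v := v) σ hx]
    rw [abs_le]
    constructor <;> linarith
  | @inf n r φ ih =>
    obtain ⟨m, ψ, hψ, δ, hδ, h⟩ := ih (hR.trans (le_max_left R r)) hε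
    refine ⟨m + 1, .inf r ψ, .inr (Set.mem_iUnion.2 ⟨r, ψ, hψ, rfl⟩), δ, hδ,
      fun v w hv hw hvw => ?_⟩
    have key : ∀ x : A, ‖x‖ ≤ r → |φ.eval σ (Fin.cons x v) - ψ.eval σ (Fin.cons x w)| ≤ ε :=
      fun x hx => h _ _ (norm_cons_le hx hv) (norm_cons_le hx hw) (norm_cons_sub_cons hvw)
    have h1 : (Formula.inf r φ).eval σ v - ε ≤ (Formula.inf r ψ).eval σ w :=
      Formula.le_eval_inf σ fun x hx => by
        linarith [(abs_le.1 (key x hx)).2, φ.eval_inf_le (v := v) σ hx]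
    have h2 : (Formula.inf r ψ).eval σ w - ε ≤ (Formula.inf r φ).eval σ v :=
      Formula.le_eval_inf σ fun x hx => by
        linarith [(abs_le.1 (key x hx)).1, ψ.eval_inf_le (v := w) σ hx]
    rw [abs_le]
    constructor <;> linarith

end Approximation

/-! ### The downward Löwenheim–Skolem theorem -/

/-- There is a countable set closed under countably many finitary operations. -/
theorem exists_countable_closed {B ι : Type*} [Countable ι] (n : ι → ℕ)
    (f : ∀ i, (Fin (n i) → B) → B) :
    ∃ D : Set B, D.Countable ∧ ∀ i v, (∀ k, v k ∈ D) → f i v ∈ D := by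
  -- Starting from `∅` is enough: operations of arity zero supply the first elements.
  let S : ℕ → Set B := fun m => m.rec ∅ fun _ D => D ∪ ⋃ i, f i '' {v | ∀ k, v k ∈ D}
  have hS : Monotone S := monotone_nat_of_le_succ fun m => Set.subset_union_left
  refine ⟨⋃ m, S m, Set.countable_iUnion fun m => ?_, fun i v hv => ?_⟩
  · induction m with
    | zero => exact Set.countable_empty
    | succ m ih =>
      exact ih.union (Set.countable_iUnion fun i => (Set.countable_pi fun _ => ih).image _)
  · choose m hm using fun k => Set.mem_iUnion.1 (hv k)
    refine Set.mem_iUnion.2 ⟨Finset.univ.sup m + 1, .inr (Set.mem_iUnion.2 ⟨i, v, fun k => ?_, rfl⟩)⟩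
    exact hS (Finset.le_sup (Finset.mem_univ k)) (hm k)

section LowenheimSkolem

variable {B : Type} [CommCStarAlgebra B] (τ : B ≃⋆ₐ[ℂ] B)

/-- The Tarski–Vaught condition for a set of elements of a structure. -/
def TarskiVaught (S : Set B) : Prop :=
  ∀ (n : ℕ) (φ : Formula (n + 1)) (r : ℕ) (v : Fin n → B), (∀ i, v i ∈ S) → ∀ ε > 0,
    ∃ x ∈ S, ‖x‖ ≤ r ∧ φ.eval τ (Fin.cons x v) < (Formula.inf r φ).eval τ v + ε

/-- `D` is closed under Skolem functions for the countably many dense formulas. Uniform continuity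
then extends the witnesses to arbitrary formulas and to parameters in the closure. -/
theorem exists_countable_tarskiVaught : ∃ D : Set B, D.Countable ∧ TarskiVaught τ (closure D) := by
  -- An index consists of the number of parameters, a dense formula, the radius `r` of the ball, and
  -- `k`, which stands for the precision `1 / (k + 1)`.
  let ι := Σ n : ℕ, (⋃ m, denseFormulas m (n + 1)) × ℕ × ℕ
  have : ∀ n, Countable (⋃ m, denseFormulas m (n + 1)) := fun n =>
    (Set.countable_iUnion fun m => countable_denseFormulas m (n + 1)).to_subtype
  choose sk hsk hlt using fun (i : ι) (v : Fin i.1 → B) =>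
    (i.2.1 : Formula (i.1 + 1)).exists_eval_lt τ i.2.2.1 v
      (show (0 : ℝ) < 1 / (i.2.2.2 + 1) by positivity)
  obtain ⟨D, hD, hc⟩ := exists_countable_closed (fun i : ι => i.1) sk
  refine ⟨D, hD, fun n φ r v hv ε hε => ?_⟩
  -- Three errors of at most `ε / 4` occur: from `φ` to `ψ` at the witness, in the choice of the
  -- witness, and between the two infima.
  have hε4 : 0 < ε / 4 := by positivity
  have hR : (0 : ℝ) ≤ max (‖v‖ + 1) r := le_max_of_le_right (by positivity)
  obtain ⟨m, ψ, hψ, δ, hδ, h⟩ := φ.exists_approx τ hR hε4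
  obtain ⟨k, hk⟩ := exists_nat_one_div_lt hε4
  choose w hwD hw using fun i => Metric.mem_closure_iff.1 (hv i) (min δ 1) (lt_min hδ one_pos)
  have hvw : ‖v - w‖ ≤ min δ 1 := (pi_norm_le_iff_of_nonneg (lt_min hδ one_pos).le).2 fun i => by
    simpa [dist_eq_norm] using (hw i).le
  have hw' : ‖w‖ ≤ ‖v‖ + 1 := by
    have := norm_sub_norm_le w v
    rw [norm_sub_rev] at this
    linarith [hvw.trans (min_le_right _ _)]
  have key : ∀ x : B, ‖x‖ ≤ r → |φ.eval τ (Fin.cons x v) - ψ.eval τ (Fin.cons x w)| ≤ ε / 4 :=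
    fun x hx => h _ _ (norm_cons_le hx (by linarith)) (norm_cons_le hx hw')
      (norm_cons_sub_cons (hvw.trans (min_le_left _ _)))
  let i : ι := ⟨n, ⟨ψ, Set.mem_iUnion.2 ⟨m, hψ⟩⟩, r, k⟩
  refine ⟨sk i w, subset_closure (hc i w hwD), hsk i w, ?_⟩
  have h1 : ψ.eval τ (Fin.cons (sk i w) w) < (Formula.inf r ψ).eval τ w + 1 / (k + 1) := hlt i w
  have h2 : (Formula.inf r ψ).eval τ w - ε / 4 ≤ (Formula.inf r φ).eval τ v :=
    Formula.le_eval_inf τ fun x hx => by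
      linarith [(abs_le.1 (key x hx)).1, ψ.eval_inf_le (v := w) τ hx]
  linarith [(abs_le.1 (key _ (hsk i w))).2]

variable {τ}

/-- Negation is a connective, so suprema reduce to infima. -/
theorem TarskiVaught.exists_lt_eval {S : Set B} (hS : TarskiVaught τ S) {n : ℕ}
    (φ : Formula (n + 1)) (r : ℕ) (v : Fin n → B) (hv : ∀ i, v i ∈ S) {ε : ℝ} (hε : 0 < ε) :
    ∃ x ∈ S, ‖x‖ ≤ r ∧ (Formula.sup r φ).eval τ v - ε < φ.eval τ (Fin.cons x v) := by
  let neg : C(Fin 1 → ℝ, ℝ) := ⟨fun x => -x 0, by fun_prop⟩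
  obtain ⟨x, hx, hxr, h⟩ := hS n (.conn neg fun _ => φ) r v hv ε hε
  have e : ∀ w, (Formula.conn neg fun _ => φ).eval τ w = -φ.eval τ w := fun w => rfl
  have h2 : (Formula.sup r φ).eval τ v ≤ -(Formula.inf r (.conn neg fun _ => φ)).eval τ v :=
    Formula.eval_sup_le τ fun y hy => by
      have := Formula.eval_inf_le (φ := .conn neg fun _ => φ) (v := v) τ hy
      rw [e] at this
      linarith
  rw [e] at h
  exact ⟨x, hx, hxr, by linarith⟩

/-- The norm of the term is the distance from `x` to `y`, and its infimum over a ball containing `y`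
is `0`. Thus `S` has points arbitrarily close to `y`. Taking for `y` the result of an operation
shows that `S` is closed under that operation. -/
theorem TarskiVaught.mem_of_term {S : Set B} (hS : TarskiVaught τ S) (hc : IsClosed S) {n : ℕ}
    (t : Term (n + 1)) (v : Fin n → B) (hv : ∀ i, v i ∈ S) {y : B}
    (hy : ∀ x, ‖t.eval τ (Fin.cons x v)‖ = ‖x - y‖) : y ∈ S := by
  obtain ⟨r, hr⟩ := exists_nat_ge ‖y‖
  rw [← hc.closure_eq, Metric.mem_closure_iff]
  intro ε hε
  obtain ⟨x, hx, -, h⟩ := hS n (.normOf t) r v hv ε hε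
  have h0 := Formula.eval_inf_le (φ := .normOf t) (v := v) τ hr
  have e : ∀ x, (Formula.normOf t).eval τ (Fin.cons x v) = ‖x - y‖ := hy
  rw [e, sub_self, norm_zero] at h0
  rw [e] at h
  exact ⟨x, hx, by rw [dist_comm, dist_eq_norm]; linarith⟩

/-- A closed set with the Tarski–Vaught property is a substructure. -/
def TarskiVaught.toStarSubalgebra {S : Set B} (hS : TarskiVaught τ S) (hc : IsClosed S) :
    StarSubalgebra ℂ B where
  carrier := S
  mul_mem' {a b} ha hb :=
    hS.mem_of_term hc (.plus (.var 0) (.smul (-1) (.times (.var 1) (.var 2)))) ![a, b]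
      (by simp [Fin.forall_fin_two, ha, hb]) fun x => by
        congr 1
        have h2 : (2 : Fin 3) = Fin.succ 1 := rfl
        have h1 : (1 : Fin 3) = Fin.succ 0 := rfl
        simp only [Term.eval, h1, h2, Fin.cons_zero, Fin.cons_succ]
        simp [sub_eq_add_neg]
  add_mem' {a b} ha hb :=
    hS.mem_of_term hc (.plus (.var 0) (.smul (-1) (.plus (.var 1) (.var 2)))) ![a, b]
      (by simp [Fin.forall_fin_two, ha, hb]) fun x => by
        congr 1
        have h2 : (2 : Fin 3) = Fin.succ 1 := rfl
        have h1 : (1 : Fin 3) = Fin.succ 0 := rfl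
        simp only [Term.eval, h1, h2, Fin.cons_zero, Fin.cons_succ]
        simp [sub_eq_add_neg, add_comm]
  algebraMap_mem' c :=
    hS.mem_of_term hc (.plus (.var 0) (.smul (-c) .one)) ![] (by simp) fun x => by
      simp [Term.eval, Algebra.algebraMap_eq_smul_one, sub_eq_add_neg]
  star_mem' {a} ha :=
    hS.mem_of_term hc (.plus (.var 0) (.smul (-1) (.adj (.var 1)))) ![a] (by simp [ha])
      fun x => by
        have h1 : (1 : Fin 2) = Fin.succ 0 := rfl
        simp only [Term.eval, h1, Fin.cons_zero, Fin.cons_succ]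
        simp [sub_eq_add_neg]

theorem TarskiVaught.map_mem {S : Set B} (hS : TarskiVaught τ S) (hc : IsClosed S) {a : B}
    (ha : a ∈ S) : τ a ∈ S :=
  hS.mem_of_term hc (.plus (.var 0) (.smul (-1) (.aut (.var 1)))) ![a] (by simp [ha])
    fun x => by
      have h1 : (1 : Fin 2) = Fin.succ 0 := rfl
      simp only [Term.eval, h1, Fin.cons_zero, Fin.cons_succ]
      simp [sub_eq_add_neg]

/-- The inverse automorphism has no symbol in the language, but `‖τ x - a‖ = ‖x - τ⁻¹ a‖` because
`τ` is isometric. -/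
theorem TarskiVaught.symm_map_mem {S : Set B} (hS : TarskiVaught τ S) (hc : IsClosed S) {a : B}
    (ha : a ∈ S) : τ.symm a ∈ S :=
  hS.mem_of_term hc (.plus (.aut (.var 0)) (.smul (-1) (.var 1))) ![a] (by simp [ha])
    fun x => by
      have h1 : (1 : Fin 2) = Fin.succ 0 := rfl
      rw [← StarAlgEquiv.norm_map τ (x - _)]
      simp only [Term.eval, h1, Fin.cons_zero, Fin.cons_succ]
      simp [sub_eq_add_neg]

end LowenheimSkolem

section Restriction

variable {B : Type} [CommCStarAlgebra B] {τ : B ≃⋆ₐ[ℂ] B} (S : StarSubalgebra ℂ B)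
  (h : ∀ x ∈ S, τ x ∈ S) (h' : ∀ x ∈ S, τ.symm x ∈ S)

/-- The restriction of an automorphism to an invariant subalgebra. -/
def restrictAut : S ≃⋆ₐ[ℂ] S where
  toFun x := ⟨τ x, h x x.2⟩
  invFun x := ⟨τ.symm x, h' x x.2⟩
  left_inv x := by simp
  right_inv x := by simp
  map_mul' x y := by ext; simp
  map_add' x y := by ext; simp
  map_star' x := by ext; simp [map_star]
  map_smul' c x := by ext; simp

theorem TarskiVaught.isElementaryEmbedding [IsClosed (S : Set B)]
    (hS : TarskiVaught τ (S : Set B)) :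
    IsElementaryEmbedding (restrictAut S h h') τ S.subtype := by
  have ht : ∀ (n : ℕ) (t : Term n) (v : Fin n → S),
      t.eval τ (fun i => (v i : B)) = (t.eval (restrictAut S h h') v : S) := by
    intro n t v
    induction t with
    | var i => rfl
    | zero => rfl
    | one => rfl
    | plus s t hs ht => simp [Term.eval, hs, ht]
    | times s t hs ht => simp [Term.eval, hs, ht]
    | smul c t ht => simp [Term.eval, ht]
    | adj t ht => simp [Term.eval, ht]
    | aut t ht => simp [Term.eval, ht]; rfl
  have hcons : ∀ {n : ℕ} (x : S) (v : Fin n → S),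
      (Fin.cons (x : B) fun i => (v i : B)) = fun i => ((Fin.cons x v : Fin (n + 1) → S) i : B) :=
    fun x v => by ext i; refine Fin.cases rfl (fun i => rfl) i
  intro n φ
  induction φ with
  | normOf t => intro v; exact congrArg norm (ht _ t v)
  | conn u φ ih => intro v; exact congrArg u (funext fun i => ih i v)
  | @sup n r φ ih =>
    intro v
    have ih' := fun (x : S) => (congrArg (φ.eval τ) (hcons x v)).trans (ih (Fin.cons x v))
    refine le_antisymm (le_of_forall_pos_le_add fun ε hε => ?_) ?_
    · obtain ⟨x, hx, hxr, hlt⟩ := hS.exists_lt_eval φ r _ (fun i => (v i).2) hε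
      have := ih' ⟨x, hx⟩
      have h2 := φ.le_eval_sup (v := v) (restrictAut S h h') (x := ⟨x, hx⟩) hxr
      simp only [StarSubalgebra.coe_subtype] at *
      linarith
    · exact Formula.eval_sup_le _ fun x hx => (ih' x).symm.trans_le (φ.le_eval_sup τ hx)
  | @inf n r φ ih =>
    intro v
    have ih' := fun (x : S) => (congrArg (φ.eval τ) (hcons x v)).trans (ih (Fin.cons x v))
    refine le_antisymm ?_ (le_of_forall_pos_le_add fun ε hε => ?_)
    · exact Formula.le_eval_inf _ fun x hx => (φ.eval_inf_le τ hx).trans_eq (ih' x)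
    · obtain ⟨x, hx, hxr, hlt⟩ := hS n φ r _ (fun i => (v i).2) ε hε
      have := ih' ⟨x, hx⟩
      have h2 := φ.eval_inf_le (v := v) (restrictAut S h h') (x := ⟨x, hx⟩) hxr
      simp only [StarSubalgebra.coe_subtype] at *
      linarith

end Restriction

/-- The downward Löwenheim–Skolem theorem: every structure has a separable elementary
substructure. -/
theorem exists_separable_elementary_substructure {B : Type} [CommCStarAlgebra B]
    (τ : B ≃⋆ₐ[ℂ] B) :
    ∃ (A₀ : Type) (_ : CommCStarAlgebra A₀) (_ : TopologicalSpace.SeparableSpace A₀)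
      (σ₀ : A₀ ≃⋆ₐ[ℂ] A₀) (j : A₀ →⋆ₐ[ℂ] B), IsElementaryEmbedding σ₀ τ j := by
  obtain ⟨D, hD, hTV⟩ := exists_countable_tarskiVaught τ
  let S := hTV.toStarSubalgebra isClosed_closure
  have hc : IsClosed (S : Set B) := isClosed_closure
  have hsep : TopologicalSpace.IsSeparable (S : Set B) := hD.isSeparable.closure
  exact ⟨S, inferInstance, hsep.separableSpace,
    restrictAut S (fun _ => hTV.map_mem hc) fun _ => hTV.symm_map_mem hc,
    S.subtype, TarskiVaught.isElementaryEmbedding S _ _ hTV⟩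

/-! ### Łoś's theorem -/

theorem cons_family {ι : Type*} {A : ι → Type} [∀ i, CommCStarAlgebra (A i)]
    {n : ℕ} (x : lp A ∞) (f : Fin n → lp A ∞) (i : ι) :
    (Fin.cons (x i) fun k => f k i) =
      fun k => ((Fin.cons x f : Fin (n + 1) → lp A ∞) k : ∀ i, A i) i := by
  ext k
  exact Fin.cases rfl (fun _ => rfl) k

section Los

variable {ι : Type*} (U : Ultrafilter ι) {A : ι → Type} [∀ i, CommCStarAlgebra (A i)]
  [∀ i, Nontrivial (A i)]

/-- The quotient norm is the ultralimit of the norms. For the lower bound, an event that does not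
hold `U`-almost everywhere fails `U`-almost everywhere, and then `norm_mk_le` bounds the quotient
norm. -/
theorem Ultraproduct.tendsto_norm (f : lp A ∞) :
    Filter.Tendsto (fun i => ‖f i‖) U (𝓝 ‖Ultraproduct.mk U A f‖) := by
  refine tendsto_order.2 ⟨fun a ha => ?_, fun a ha => eventually_lt_of_norm_mk_lt U ha⟩
  rcases lt_or_ge a 0 with h | h
  · exact .of_forall fun i => h.trans_le (norm_nonneg _)
  · by_contra hcon
    rw [← Ultrafilter.eventually_not] at hcon
    exact ha.not_ge (norm_mk_le U h (hcon.mono fun i hi => not_lt.1 hi))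

variable {U} in
-- Quantifiers range over closed balls of fixed radius, so Łoś's theorem needs representatives that
-- lie in the same ball in every coordinate. Coordinates that are too long are rescaled to length
-- `r`; the change tends to `0` along `U` since `‖g i‖` tends to `‖x‖ ≤ r`.
theorem Ultraproduct.exists_lift {x : Ultraproduct U A} {r : ℝ} (hr : 0 ≤ r) (hx : ‖x‖ ≤ r) :
    ∃ f : lp A ∞, Ultraproduct.mk U A f = x ∧ ∀ i, ‖f i‖ ≤ r := by
  obtain ⟨g, rfl⟩ := Ultraproduct.mk_surjective U x
  let c : ι → ℝ := fun i => if ‖g i‖ ≤ r then 1 else r / ‖g i‖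
  have hc : ∀ i, ‖((c i : ℂ)) • g i‖ ≤ r := fun i => by
    rw [norm_smul, Complex.norm_real]
    by_cases h : ‖g i‖ ≤ r
    · simp [c, h]
    · have h0 : 0 < ‖g i‖ := hr.trans_lt (not_le.1 h)
      simp only [c, if_neg h, norm_div, norm_norm, Real.norm_of_nonneg hr]
      rw [div_mul_cancel₀ _ h0.ne']
  let f : lp A ∞ := ⟨fun i => (c i : ℂ) • g i, memℓp_infty ⟨r, by rintro _ ⟨i, rfl⟩; exact hc i⟩⟩
  refine ⟨f, ?_, hc⟩
  refine (Ideal.Quotient.eq (I := nullIdeal U A)).2 ((mem_nullIdeal_iff U).2 fun ε hε => ?_)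
  filter_upwards [(Ultraproduct.tendsto_norm U g).eventually_lt_const
    (lt_of_le_of_lt hx (lt_add_of_pos_right r hε))] with i hi
  have e : (f - g) i = ((c i - 1 : ℝ) : ℂ) • g i := by
    change (c i : ℂ) • g i - g i = _
    push_cast
    module
  rw [e, norm_smul, Complex.norm_real]
  by_cases h : ‖g i‖ ≤ r
  · simpa [c, h] using hε
  · have h0 : 0 < ‖g i‖ := hr.trans_lt (not_le.1 h)
    have h1 : r / ‖g i‖ - 1 ≤ 0 := by
      rw [sub_nonpos, div_le_one h0]
      exact (not_le.1 h).le
    simp only [c, if_neg h]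
    rw [Real.norm_of_nonpos h1, neg_sub, sub_mul, div_mul_cancel₀ _ h0.ne']
    linarith

variable (σ : ∀ i, A i ≃⋆ₐ[ℂ] A i)

theorem ultraAut_mk (f : lp A ∞) :
    ultraAut U σ (Ultraproduct.mk U A f) = Ultraproduct.mk U A (familyMap σ f) := rfl

/-- Building `g` inside `lp A ∞` along the term makes the boundedness of the family of values
automatic. -/
theorem Term.eval_ultraAut {n : ℕ} (t : Term n) (f : Fin n → lp A ∞) :
    ∃ g : lp A ∞, (∀ i, g i = t.eval (σ i) fun k => f k i) ∧
      t.eval (ultraAut U σ) (fun k => Ultraproduct.mk U A (f k)) = Ultraproduct.mk U A g := by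
  induction t with
  | var k => exact ⟨f k, fun _ => rfl, rfl⟩
  | zero => exact ⟨0, fun _ => rfl, (map_zero _).symm⟩
  | one => exact ⟨1, fun _ => rfl, (map_one _).symm⟩
  | plus s t hs ht =>
    obtain ⟨g, hg, hg'⟩ := hs
    obtain ⟨h, hh, hh'⟩ := ht
    exact ⟨g + h, fun i => congrArg₂ (· + ·) (hg i) (hh i), by rw [map_add, Term.eval, hg', hh']⟩
  | times s t hs ht =>
    obtain ⟨g, hg, hg'⟩ := hs
    obtain ⟨h, hh, hh'⟩ := ht
    exact ⟨g * h, fun i => congrArg₂ (· * ·) (hg i) (hh i), by rw [map_mul, Term.eval, hg', hh']⟩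
  | smul c t ht =>
    obtain ⟨h, hh, hh'⟩ := ht
    exact ⟨c • h, fun i => congrArg (c • ·) (hh i), by rw [map_smul, Term.eval, hh']⟩
  | adj t ht =>
    obtain ⟨h, hh, hh'⟩ := ht
    exact ⟨star h, fun i => congrArg star (hh i), by
      rw [← Ultraproduct.star_mk, Term.eval, hh']⟩
  | aut t ht =>
    obtain ⟨h, hh, hh'⟩ := ht
    exact ⟨familyMap σ h, fun i => congrArg (σ i) (hh i), by
      rw [← ultraAut_mk, Term.eval, hh']⟩

theorem cons_mk {n : ℕ} (x : lp A ∞) (f : Fin n → lp A ∞) :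
    (Fin.cons (Ultraproduct.mk U A x) fun k => Ultraproduct.mk U A (f k)) =
      fun k => Ultraproduct.mk U A ((Fin.cons x f : Fin (n + 1) → lp A ∞) k) := by
  ext k
  exact Fin.cases rfl (fun _ => rfl) k

end Los

section Los

variable {ι : Type} (U : Ultrafilter ι) {A : ι → Type} [∀ i, CommCStarAlgebra (A i)]
  [∀ i, Nontrivial (A i)] (σ : ∀ i, A i ≃⋆ₐ[ℂ] A i)

/-- The value of a formula in an ultraproduct is the ultralimit of its values in the factors. -/
theorem Formula.tendsto_eval {n : ℕ} (φ : Formula n) (f : Fin n → lp A ∞) :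
    Filter.Tendsto (fun i => φ.eval (σ i) fun k => f k i) U
      (𝓝 (φ.eval (ultraAut U σ) fun k => Ultraproduct.mk U A (f k))) := by
  induction φ with
  | normOf t =>
    obtain ⟨g, hg, hg'⟩ := t.eval_ultraAut U σ f
    simp only [Formula.eval, hg', ← hg]
    exact Ultraproduct.tendsto_norm U g
  | conn u φ ih =>
    exact (u.continuous.tendsto _).comp (tendsto_pi_nhds.2 fun k => ih k f)
  | @sup n r φ ih =>
    have ih' : ∀ x : lp A ∞, Filter.Tendsto
        (fun i => φ.eval (σ i) (Fin.cons (x i) fun k => f k i)) U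
        (𝓝 (φ.eval (ultraAut U σ)
          (Fin.cons (Ultraproduct.mk U A x) fun k => Ultraproduct.mk U A (f k)))) := fun x => by
      simpa only [cons_family, cons_mk] using ih (Fin.cons x f)
    refine tendsto_order.2 ⟨fun a ha => ?_, fun b hb => ?_⟩
    -- Lower bound: an almost optimal element of the ultraproduct is lifted to a family in the ball.
    · obtain ⟨x, hx, hlt⟩ := φ.exists_lt_eval (ultraAut U σ) r _ (sub_pos.2 ha)
      obtain ⟨x, rfl, hxr⟩ := Ultraproduct.exists_lift r.cast_nonneg hx
      rw [sub_sub_cancel] at hlt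
      filter_upwards [(ih' x).eventually_const_lt hlt] with i hi
      exact hi.trans_le (φ.le_eval_sup (σ i) (hxr i))
    -- Upper bound: almost optimal elements of the factors are assembled into one element of the
    -- ultraproduct. Half of the gap below `b` is spent on their choice and half on the limit.
    · choose x hxr hlt using fun i =>
        φ.exists_lt_eval (σ i) r (fun k => f k i) (half_pos (sub_pos.2 hb))
      let y : lp A ∞ := ⟨x, memℓp_infty ⟨r, by rintro _ ⟨i, rfl⟩; exact hxr i⟩⟩
      have hy : ‖Ultraproduct.mk U A y‖ ≤ r := norm_mk_le U r.cast_nonneg (.of_forall hxr)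
      have h := φ.le_eval_sup (v := fun k => Ultraproduct.mk U A (f k)) (ultraAut U σ) hy
      filter_upwards [(ih' y).eventually_lt_const (h.trans_lt (left_lt_add_div_two.2 hb))]
        with i hi
      have hi' : φ.eval (σ i) (Fin.cons (x i) fun k => f k i) < _ := hi
      linarith [hlt i]
  | @inf n r φ ih =>
    have ih' : ∀ x : lp A ∞, Filter.Tendsto
        (fun i => φ.eval (σ i) (Fin.cons (x i) fun k => f k i)) U
        (𝓝 (φ.eval (ultraAut U σ)
          (Fin.cons (Ultraproduct.mk U A x) fun k => Ultraproduct.mk U A (f k)))) := fun x => by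
      simpa only [cons_family, cons_mk] using ih (Fin.cons x f)
    refine tendsto_order.2 ⟨fun a ha => ?_, fun b hb => ?_⟩
    · choose x hxr hlt using fun i =>
        φ.exists_eval_lt (σ i) r (fun k => f k i) (half_pos (sub_pos.2 ha))
      let y : lp A ∞ := ⟨x, memℓp_infty ⟨r, by rintro _ ⟨i, rfl⟩; exact hxr i⟩⟩
      have hy : ‖Ultraproduct.mk U A y‖ ≤ r := norm_mk_le U r.cast_nonneg (.of_forall hxr)
      have h := φ.eval_inf_le (v := fun k => Ultraproduct.mk U A (f k)) (ultraAut U σ) hy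
      filter_upwards [(ih' y).eventually_const_lt ((add_div_two_lt_right.2 ha).trans_le h)]
        with i hi
      have hi' : _ < φ.eval (σ i) (Fin.cons (x i) fun k => f k i) := hi
      linarith [hlt i]
    · obtain ⟨x, hx, hlt⟩ := φ.exists_eval_lt (ultraAut U σ) r _ (sub_pos.2 hb)
      obtain ⟨x, rfl, hxr⟩ := Ultraproduct.exists_lift r.cast_nonneg hx
      rw [add_sub_cancel] at hlt
      filter_upwards [(ih' x).eventually_lt_const hlt] with i hi
      exact (φ.eval_inf_le (σ i) (hxr i)).trans_lt hi

theorem Models.ultraproduct {T : Theory} (h : ∀ i, Models (σ i) T) : Models (ultraAut U σ) T := by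
  intro φ hφ
  have e : ∀ i, (fun k : Fin 0 => ((Fin.elim0 k : lp A ∞) : ∀ i, A i) i) = Fin.elim0 :=
    fun i => Subsingleton.elim _ _
  have := φ.tendsto_eval U σ Fin.elim0
  simp only [e, h _ φ hφ] at this
  rw [tendsto_nhds_unique this tendsto_const_nhds |>.symm]
  exact congrArg _ (Subsingleton.elim _ _)

end Los

theorem IsElementaryEmbedding.models {A B : Type} [CommCStarAlgebra A] [CommCStarAlgebra B]
    {σ : A ≃⋆ₐ[ℂ] A} {τ : B ≃⋆ₐ[ℂ] B} {j : A →⋆ₐ[ℂ] B} (h : IsElementaryEmbedding σ τ j)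
    {T : Theory} (hT : Models τ T) : Models σ T := fun φ hφ => by
  rw [← h 0 φ Fin.elim0, ← hT φ hφ]
  exact congrArg _ (Subsingleton.elim _ _)

/-- The formula `‖x₁ - σ x₀‖` vanishes at `(x, σ x)`, hence also at the image of this pair. -/
theorem IsElementaryEmbedding.map_aut {A B : Type} [CommCStarAlgebra A] [CommCStarAlgebra B]
    {σ : A ≃⋆ₐ[ℂ] A} {τ : B ≃⋆ₐ[ℂ] B} {j : A →⋆ₐ[ℂ] B} (h : IsElementaryEmbedding σ τ j) (x : A) :
    j (σ x) = τ (j x) := by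
  have := h 2 (.normOf (.plus (.var 1) (.smul (-1) (.aut (.var 0))))) ![x, σ x]
  simp only [Formula.eval, Term.eval, Matrix.cons_val_zero, Matrix.cons_val_one] at this
  simpa [sub_eq_add_neg, add_neg_eq_zero] using this

/-! ### Odometers -/

section OdometerValue

variable (a : ℕ → ℕ)

/-- The number with the first `n` digits of `b` in the mixed radix system with bases `a`. -/
def odometerVal (b : ∀ n, Fin (a n)) (n : ℕ) : ℕ :=
  ∑ k ∈ Finset.range n, (∏ i ∈ Finset.range k, a i) * (b k : ℕ)

variable {a}

theorem odometerVal_succ (b : ∀ n, Fin (a n)) (n : ℕ) :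
    odometerVal a b (n + 1) = odometerVal a b n + (∏ i ∈ Finset.range n, a i) * (b n : ℕ) :=
  Finset.sum_range_succ _ _

theorem odometerVal_lt (b : ∀ n, Fin (a n)) (n : ℕ) :
    odometerVal a b n < ∏ i ∈ Finset.range n, a i := by
  induction n with
  | zero => simp [odometerVal]
  | succ n ih =>
    rw [odometerVal_succ, Finset.prod_range_succ]
    nlinarith [(b n).isLt, Nat.zero_le (∏ i ∈ Finset.range n, a i)]

theorem odometerVal_succ_mod (b : ∀ n, Fin (a n)) (n : ℕ) :
    odometerVal a b (n + 1) % ∏ i ∈ Finset.range n, a i = odometerVal a b n := by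
  rw [odometerVal_succ, Nat.add_mul_mod_self_left, Nat.mod_eq_of_lt (odometerVal_lt b n)]

theorem odometerVal_succ_div (b : ∀ n, Fin (a n)) (n : ℕ) :
    odometerVal a b (n + 1) / ∏ i ∈ Finset.range n, a i = b n := by
  have h := odometerVal_lt b n
  rw [odometerVal_succ, Nat.add_mul_div_left _ _ (by omega), Nat.div_eq_of_lt h, zero_add]

theorem odometerVal_add_one_eq_iff (b : ∀ n, Fin (a n)) (n : ℕ) :
    odometerVal a b n + 1 = ∏ i ∈ Finset.range n, a i ↔ ∀ i < n, (b i : ℕ) + 1 = a i := by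
  induction n with
  | zero => simp [odometerVal]
  | succ n ih =>
    rw [Nat.forall_lt_succ_right, ← ih, odometerVal_succ, Finset.prod_range_succ]
    have h := odometerVal_lt b n
    have h' := (b n).isLt
    set N := ∏ i ∈ Finset.range n, a i
    constructor
    · intro e
      have : (b n : ℕ) + 1 = a n := by
        by_contra hne
        have : (b n : ℕ) + 2 ≤ a n := by omega
        nlinarith
      have e' : N * a n = N * ((b n : ℕ) + 1) := congrArg (N * ·) this.symm
      exact ⟨by nlinarith, this⟩
    · rintro ⟨e, e'⟩
      have e'' : N * a n = N * ((b n : ℕ) + 1) := congrArg (N * ·) e'.symm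
      nlinarith

/-- The cylinders of length `n` form a factor on which the odometer is addition of one modulo the
number of cylinders. A carry reaches digit `n` exactly when the value of the earlier digits is
maximal, by `odometerVal_add_one_eq_iff`. -/
theorem odometerVal_odometer (b : ∀ n, Fin (a n)) (n : ℕ) :
    odometerVal a (odometer a b) n = (odometerVal a b n + 1) % ∏ i ∈ Finset.range n, a i := by
  induction n with
  | zero => simp [odometerVal]
  | succ n ih =>
    rw [odometerVal_succ, ih, odometerVal_succ, Finset.prod_range_succ]
    have h := odometerVal_lt b n
    have h' := (b n).isLt
    have hc := odometerVal_add_one_eq_iff b n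
    set N := ∏ i ∈ Finset.range n, a i
    by_cases hb : ∀ i < n, (b i : ℕ) + 1 = a i
    · have e : ((odometer a b n : Fin (a n)) : ℕ) = (b n + 1) % a n := by
        change (odometerFun a b n : ℕ) = _
        rw [odometerFun, if_pos hb]
      have e' : odometerVal a b n + N * (b n : ℕ) + 1 = N * ((b n : ℕ) + 1) := by
        rw [mul_add, mul_one, ← hc.2 hb]; ring
      rw [e, hc.2 hb, Nat.mod_self, zero_add, e', Nat.mul_mod_mul_left]
    · have e : ((odometer a b n : Fin (a n)) : ℕ) = b n := by
        change (odometerFun a b n : ℕ) = _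
        rw [odometerFun, if_neg hb]
      have h1 : odometerVal a b n + 1 < N := lt_of_le_of_ne h (mt hc.1 hb)
      rw [e, Nat.mod_eq_of_lt h1, Nat.mod_eq_of_lt (by nlinarith)]
      ring

theorem odometerVal_iterate (b : ∀ n, Fin (a n)) (n k : ℕ) :
    odometerVal a ((odometer a)^[k] b) n = (odometerVal a b n + k) % ∏ i ∈ Finset.range n, a i := by
  induction k with
  | zero => exact (Nat.mod_eq_of_lt (odometerVal_lt b n)).symm
  | succ k ih =>
    rw [Function.iterate_succ_apply', odometerVal_odometer, ih, Nat.mod_add_mod, add_assoc]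

theorem odometerVal_eq_of_le {b c : ∀ n, Fin (a n)} {m n : ℕ} (hmn : m ≤ n)
    (h : odometerVal a b n = odometerVal a c n) : odometerVal a b m = odometerVal a c m := by
  induction n, hmn using Nat.le_induction with
  | base => exact h
  | succ n _ ih => exact ih (by rw [← odometerVal_succ_mod, h, odometerVal_succ_mod])

theorem eq_of_odometerVal_eq {b c : ∀ n, Fin (a n)} {k n : ℕ} (hk : k < n)
    (h : odometerVal a b n = odometerVal a c n) : b k = c k := by
  ext
  rw [← odometerVal_succ_div, odometerVal_eq_of_le hk h, odometerVal_succ_div]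

/-- Iterates of an odometer along multiples of the orders of its finite factors converge
pointwise to the identity. -/
theorem tendsto_odometer_iterate (b : ∀ n, Fin (a n)) (k : ℕ → ℕ)
    (hk : ∀ n, ∏ i ∈ Finset.range n, a i ∣ k n) :
    Filter.Tendsto (fun n => (odometer a)^[k n] b) Filter.atTop (𝓝 b) := by
  refine tendsto_pi_nhds.2 fun m => tendsto_nhds_of_eventually_eq ?_
  filter_upwards [Filter.eventually_gt_atTop m] with n hn
  refine eq_of_odometerVal_eq hn ?_
  obtain ⟨d, hd⟩ := hk n
  rw [odometerVal_iterate, hd, Nat.add_mul_mod_self_left, Nat.mod_eq_of_lt (odometerVal_lt b n)]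

theorem continuous_odometerVal (n : ℕ) : Continuous fun b => odometerVal a b n := by
  have : ∀ k, Continuous fun b : ∀ n, Fin (a n) => (b k : ℕ) := fun k =>
    continuous_of_discreteTopology.comp (continuous_apply k)
  unfold odometerVal
  fun_prop

end OdometerValue

/-- Compatible factor maps onto cyclic permutations of lengths `∏ a i` give odometer partitions. -/
theorem hasOdometerPartitions_of_factors {X : Type*} [TopologicalSpace X] [Nonempty X]
    {S : X ≃ₜ X} {a : ℕ → ℕ} (ha : ∀ n, 2 ≤ a n) (W : ℕ → X → ℕ) (hW : ∀ n, Continuous (W n))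
    (hlt : ∀ n x, W n x < ∏ i ∈ Finset.range n, a i)
    (hmod : ∀ n x, W (n + 1) x % ∏ i ∈ Finset.range n, a i = W n x)
    (hS : ∀ n x, W n (S x) = (W n x + 1) % ∏ i ∈ Finset.range n, a i) :
    HasOdometerPartitions S := by
  let N : ℕ → ℕ := fun n => ∏ i ∈ Finset.range n, a i
  have hN : ∀ n, N (n + 1) = N n * a n := fun n => Finset.prod_range_succ _ _
  have hN0 : ∀ n, 0 < N n := fun n => Finset.prod_pos fun i _ => by linarith [ha i]
  have hiter : ∀ n k x, W n (S^[k] x) = (W n x + k) % N n := by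
    intro n k x
    induction k with
    | zero => exact (Nat.mod_eq_of_lt (hlt n x)).symm
    | succ k ih => rw [Function.iterate_succ_apply', hS, ih, Nat.mod_add_mod, add_assoc]
  have hreach : ∀ n x, ∀ l < N n, ∃ k, (W n x + k) % N n = l := fun n x l hl =>
    -- This is `l - W n x` modulo `N n`, shifted by `N n` to stay in the natural numbers.
    ⟨l + (N n - W n x), by
      have : W n x < N n := hlt n x
      rw [show W n x + (l + (N n - W n x)) = l + N n by omega, Nat.add_mod_right,
        Nat.mod_eq_of_lt hl]⟩
  have hsurj : ∀ n, ∀ l < N n, ∃ x, W n x = l := fun n l hl => by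
    obtain ⟨x⟩ := ‹Nonempty X›
    obtain ⟨k, hk⟩ := hreach n x l hl
    exact ⟨S^[k] x, by rw [hiter, hk]⟩
  let F : ℕ → ℕ → Set X := fun n l => W n ⁻¹' {l}
  have hFne : ∀ n, ∀ l < N n, (F n l).Nonempty := hsurj
  have hFinj : ∀ n, Set.InjOn (F n) (Set.Iio (N n)) := by
    intro n l hl m hm e
    obtain ⟨x, hx⟩ := hFne n l hl
    have hx' := e ▸ hx
    exact hx.symm.trans hx'
  have hsub : ∀ n, ∀ l < N n, ∀ m < N (n + 1), (F (n + 1) m ⊆ F n l ↔ m % N n = l) := by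
    intro n l hl m hm
    constructor
    · intro h
      obtain ⟨x, hx⟩ := hFne _ m hm
      have hx' : W n x = l := h hx
      rw [← hx', ← hmod n x, show W (n + 1) x = m from hx]
    · rintro rfl x rfl
      exact (hmod n x).symm
  have himage : ∀ n k, ∀ l < N n, S^[k] '' F n l = F n ((l + k) % N n) := by
    intro n k l hl
    ext y
    constructor
    · rintro ⟨x, rfl, rfl⟩
      exact hiter n k x
    · intro hy
      obtain ⟨x, rfl⟩ := (S.bijective.iterate k).2 y
      have hy' : (W n x + k) % N n = (l + k) % N n := (hiter n k x).symm.trans hy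
      refine ⟨x, ?_, rfl⟩
      exact (Nat.ModEq.add_right_cancel' k hy').eq_of_lt_of_lt (hlt n x) hl
  refine ⟨a, fun n => F n '' Set.Iio (N n), ha, ?_, fun n => ?_, ?_, fun n => ?_, fun n => ?_, ?_,
    ?_, ?_⟩
  · have e : Set.Iio (N 0) = {0} := by
      ext; simp [N]
    have e' : F 0 0 = Set.univ := Set.eq_univ_of_forall fun x => by
      have := hlt 0 x
      show W 0 x = 0
      simpa using this
    simp only [e, Set.image_singleton, e']
  · rw [(hFinj n).ncard_image, ← Nat.card_coe_set_eq]
    simp [N]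
  · rintro n _ ⟨l, hl, rfl⟩
    exact ⟨(isClopen_discrete {l}).preimage (hW n), hFne n l hl⟩
  · rintro _ ⟨l, hl, rfl⟩ _ ⟨m, hm, rfl⟩ hne
    refine Disjoint.preimage _ (Set.disjoint_singleton.2 ?_)
    rintro rfl
    exact hne rfl
  · exact Set.eq_univ_of_forall fun x => ⟨F n (W n x), ⟨W n x, hlt n x, rfl⟩, rfl⟩
  · rintro n _ ⟨l, hl, rfl⟩
    have hl' : l < N n := hl
    have hm : ∀ i < a n, l + N n * i < N (n + 1) := fun i hi => by
      rw [hN]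
      nlinarith
    -- The fibres below `F n l` belong to the residues modulo `N (n + 1)` that reduce to `l` modulo
    -- `N n`; there are `a n` of them.
    have e : {B' ∈ F (n + 1) '' Set.Iio (N (n + 1)) | B' ⊆ F n l} =
        (fun i => F (n + 1) (l + N n * i)) '' Set.Iio (a n) := by
      ext B
      constructor
      · rintro ⟨⟨m, hm, rfl⟩, h⟩
        have hm' : m < N n * a n := hN n ▸ hm
        refine ⟨m / N n, Nat.div_lt_of_lt_mul hm', ?_⟩
        rw [← (hsub n l hl m hm).1 h]
        simp only [Nat.mod_add_div]
      · rintro ⟨i, hi, rfl⟩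
        refine ⟨⟨_, hm i hi, rfl⟩, (hsub n l hl _ (hm i hi)).2 ?_⟩
        rw [Nat.add_mul_mod_self_left, Nat.mod_eq_of_lt hl]
    constructor
    · have hinj : Set.InjOn (fun i => F (n + 1) (l + N n * i)) (Set.Iio (a n)) := by
        intro i hi i' hi' h
        have := hFinj (n + 1) (hm i hi) (hm i' hi') h
        exact Nat.eq_of_mul_eq_mul_left (hN0 n) (Nat.add_left_cancel this)
      rw [e, hinj.ncard_image, ← Nat.card_coe_set_eq]
      simp
    · refine subset_antisymm (Set.sUnion_subset fun B hB => hB.2) fun x hx => ?_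
      refine ⟨F (n + 1) (W (n + 1) x), ⟨⟨_, hlt _ x, rfl⟩, ?_⟩, rfl⟩
      rw [hsub n l hl _ (hlt _ x), hmod]
      exact hx
  · rintro n _ ⟨l, hl, rfl⟩
    have := himage n 1 l hl
    rw [Function.iterate_one] at this
    exact ⟨_, Nat.mod_lt _ (hN0 n), this.symm⟩
  · rintro n _ ⟨l, hl, rfl⟩ _ ⟨m, hm, rfl⟩
    obtain ⟨x, rfl⟩ := hsurj n l hl
    obtain ⟨k, hk⟩ := hreach n x m hm
    exact ⟨k, by rw [himage n k _ hl, hk]⟩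

/-- This reduces the non-axiomatizability to the obstruction proved for the ultraproduct. -/
theorem IsOdometer.hasOdometerPartitions {X : Type} [TopologicalSpace X] {S : X ≃ₜ X}
    (h : IsOdometer X S) : HasOdometerPartitions S := by
  obtain ⟨a, ha, e, he⟩ := h
  have : Nonempty X := ⟨e.symm fun n => ⟨0, by linarith [ha n]⟩⟩
  exact hasOdometerPartitions_of_factors ha (fun n x => odometerVal a (e x) n)
    (fun n => (continuous_odometerVal n).comp e.continuous) (fun n x => odometerVal_lt (e x) n)
    (fun n x => odometerVal_succ_mod (e x) n)
    fun n x => by simp only [he, odometerVal_odometer]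

/-! ### Almost idempotents that almost sum up to one along an orbit -/

theorem inducedAut_iterate {X : Type*} [TopologicalSpace X] [CompactSpace X] (S : X ≃ₜ X)
    (f : C(X, ℂ)) (k : ℕ) (x : X) : ((inducedAut S)^[k] f) x = f (S^[k] x) := by
  induction k generalizing f with
  | zero => rfl
  | succ k ih =>
    rw [Function.iterate_succ_apply, ih, Function.iterate_succ_apply']
    rfl

/-- A sequence of complex numbers which are close to idempotents and whose sums over windows of
length `a` are close to `1` is close to an `a`-periodic sequence of zeros and ones. -/
theorem exists_rounding {z : ℕ → ℂ} {a : ℕ} (ha : 2 ≤ a) {ε : ℝ} (hε : ε * (8 * a) = 1)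
    (h1 : ∀ k, ‖z k * z k - z k‖ ≤ ε) (h2 : ∀ k, ‖∑ i ∈ Finset.range a, z (k + i) - 1‖ ≤ ε) :
    ∃ e : ℕ → ℕ, (∀ k, ‖z k - e k‖ ≤ 2 * ε) ∧ (∀ k, ∑ i ∈ Finset.range a, e (k + i) = 1) ∧
      ∀ k m, e (k + a * m) = e k := by
  have ha' : (2 : ℝ) ≤ a := by exact_mod_cast ha
  have hε0 : 0 < ε := by
    by_contra h
    nlinarith
  -- In `‖z‖ * ‖z - 1‖ ≤ ε` one factor is at least `1 / 2`, so the other is at most `2 * ε`.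
  let e : ℕ → ℕ := fun k => if ‖z k‖ < 1 / 2 then 0 else 1
  have he : ∀ k, ‖z k - e k‖ ≤ 2 * ε := by
    intro k
    have h := h1 k
    have : z k * z k - z k = z k * (z k - 1) := by ring
    rw [this, norm_mul] at h
    by_cases hk : ‖z k‖ < 1 / 2
    · have h3 : 1 / 2 ≤ ‖z k - 1‖ := by
        have := norm_sub_norm_le (1 : ℂ) (z k)
        rw [norm_sub_rev, norm_one] at this
        linarith
      simp only [e, if_pos hk, Nat.cast_zero, sub_zero]
      nlinarith [norm_nonneg (z k)]
    · simp only [e, if_neg hk, Nat.cast_one]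
      nlinarith [norm_nonneg (z k - 1)]
  have hsum : ∀ k, ∑ i ∈ Finset.range a, e (k + i) = 1 := by
    intro k
    have h3 : ‖∑ i ∈ Finset.range a, ((e (k + i) : ℂ) - z (k + i))‖ ≤ a * (2 * ε) := by
      refine (norm_sum_le_of_le (Finset.range a) fun i _ => ?_).trans_eq
        (b := ∑ i ∈ Finset.range a, 2 * ε) (by simp)
      rw [norm_sub_rev]
      exact he _
    -- The total error is at most `a * (2 * ε) + ε = 1 / 4 + 1 / (8 * a) < 1`, and an integer at
    -- distance less than `1` from `1` is `1`.
    have h4 : ‖((∑ i ∈ Finset.range a, e (k + i) : ℕ) : ℂ) - 1‖ < 1 := by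
      have e1 : ((∑ i ∈ Finset.range a, e (k + i) : ℕ) : ℂ) - 1 =
          ∑ i ∈ Finset.range a, ((e (k + i) : ℂ) - z (k + i)) +
            (∑ i ∈ Finset.range a, z (k + i) - 1) := by
        rw [Finset.sum_sub_distrib]
        push_cast
        ring
      rw [e1]
      refine (norm_add_le_of_le h3 (h2 k)).trans_lt ?_
      nlinarith
    generalize ∑ i ∈ Finset.range a, e (k + i) = s at h4
    have h5 : ‖(((s : ℤ) - 1 : ℤ) : ℂ)‖ < 1 := by
      push_cast
      exact h4
    rw [Complex.norm_intCast] at h5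
    have h6 : |(s : ℤ) - 1| < 1 := by exact_mod_cast h5
    rw [Int.abs_lt_one_iff] at h6
    omega
  -- Consecutive windows have equal sums; they differ by losing `e k` and gaining `e (k + a)`.
  have hper : ∀ k, e (k + a) = e k := by
    intro k
    have h3 := Finset.sum_range_succ (fun i => e (k + i)) a
    have h4 := Finset.sum_range_succ' (fun i => e (k + i)) a
    have h5 := hsum (k + 1)
    have h6 : ∀ i, k + 1 + i = k + (i + 1) := fun i => by ring
    simp only [h6] at h5
    rw [hsum k] at h3
    rw [h5] at h4
    simp only [add_zero] at h4
    omega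
  refine ⟨e, he, hsum, fun k m => ?_⟩
  induction m with
  | zero => rfl
  | succ m ih => rw [← ih, ← hper (k + a * m)]; congr 1; ring

/-- In the `p`-adic odometer, there is no approximate partition of unity into idempotents that is
permuted in a cycle of a length `a ≥ 2` prime to `p`. -/
theorem pOdometer_not_approx_partition {p a : ℕ} (hp : 0 < p) (ha : 2 ≤ a) (hpa : Nat.Coprime p a)
    {ε : ℝ} (hε : ε * (8 * a) = 1) (f : C(ℕ → Fin p, ℂ)) (h1 : ‖f * f - f‖ ≤ ε)
    (h2 : ‖∑ i ∈ Finset.range a, (pOdometerAut p)^[i] f - 1‖ ≤ ε) : False := by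
  let S := odometer fun _ => p
  let y : ℕ → Fin p := fun _ => ⟨0, hp⟩
  have ha' : (2 : ℝ) ≤ a := by exact_mod_cast ha
  obtain ⟨e, he, hsum, hper⟩ := exists_rounding (z := fun k => f (S^[k] y)) ha hε
    (fun k => ((f * f - f).norm_coe_le_norm (S^[k] y)).trans h1) fun k => by
      refine le_trans (le_of_eq ?_) (((∑ i ∈ Finset.range a, (pOdometerAut p)^[i] f -
        1).norm_coe_le_norm (S^[k] y)).trans h2)
      simp only [ContinuousMap.sub_apply, ContinuousMap.one_apply, ContinuousMap.sum_apply,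
        pOdometerAut, inducedAut_iterate]
      congr 2
      refine Finset.sum_congr rfl fun i _ => ?_
      rw [add_comm k i, Function.iterate_add_apply]
  have hstep : ∀ k, e (k + 1) = e k := by
    intro k
    have hpos : 0 < a.totient := Nat.totient_pos.2 (by omega)
    -- These times are divisible by `p ^ n`, so the orbit returns to `y` in the limit. By Euler's
    -- theorem they are also `1` modulo `a`, so in the `a`-periodic sequence `e` they act as a shift
    -- by one.
    have ht := tendsto_odometer_iterate (a := fun _ => p) y (fun n => p ^ (a.totient * n))
      fun n => by
        rw [Finset.prod_const, Finset.card_range]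
        exact pow_dvd_pow p (Nat.le_mul_of_pos_left n hpos)
    have hc : Continuous fun x => f (S^[k] x) := f.continuous.comp (S.continuous.iterate k)
    obtain ⟨n, hn⟩ := (((hc.tendsto y).comp ht).eventually
      (Metric.ball_mem_nhds _ one_half_pos)).exists
    have hmod : p ^ (a.totient * n) % a = 1 := by
      have := (Nat.ModEq.pow_totient hpa).pow n
      rw [one_pow, ← pow_mul] at this
      rw [this, Nat.mod_eq_of_lt ha]
    have hm := Nat.mod_add_div (p ^ (a.totient * n)) a
    rw [hmod] at hm
    have hn' : dist (f (S^[k + p ^ (a.totient * n)] y)) (f (S^[k] y)) < 1 / 2 := by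
      rw [Function.iterate_add_apply]
      exact hn
    have h3 := he (k + p ^ (a.totient * n))
    have h4 := he k
    -- The two values of `f` differ by less than `1 / 2` and the two rounding errors add at most `4
    -- * ε ≤ 1 / 4`, so the integers coincide.
    have h5 : ‖(((e (k + p ^ (a.totient * n)) : ℤ) - (e k : ℤ) : ℤ) : ℂ)‖ < 1 := by
      have e1 : (((e (k + p ^ (a.totient * n)) : ℤ) - (e k : ℤ) : ℤ) : ℂ) =
          (f (S^[k + p ^ (a.totient * n)] y) - f (S^[k] y)) + ((f (S^[k] y) - e k) -
            (f (S^[k + p ^ (a.totient * n)] y) - e (k + p ^ (a.totient * n)))) := by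
        push_cast
        ring
      rw [e1]
      rw [dist_eq_norm] at hn'
      refine (norm_add_le_of_le hn'.le (norm_sub_le_of_le h4 h3)).trans_lt ?_
      nlinarith
    rw [Complex.norm_intCast] at h5
    have h6 : |(e (k + p ^ (a.totient * n)) : ℤ) - e k| < 1 := by exact_mod_cast h5
    rw [Int.abs_lt_one_iff] at h6
    rw [← hper (k + 1) (p ^ (a.totient * n) / a), add_assoc, hm]
    omega
  have hconst : ∀ k, e k = e 0 := fun k => by
    induction k with
    | zero => rfl
    | succ k ih => rw [hstep, ih]
  have := hsum 0
  simp only [hconst, Finset.sum_const, Finset.card_range, smul_eq_mul] at this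
  have := Nat.eq_one_of_mul_eq_one_right this
  omega

/-- Odometer partitions give an idempotent whose translates over a cycle sum up to one. -/
theorem HasOdometerPartitions.exists_idempotent {Y : Type*} [TopologicalSpace Y] [CompactSpace Y]
    {τ : Y ≃ₜ Y} (h : HasOdometerPartitions τ) :
    ∃ a, 2 ≤ a ∧ ∃ f : C(Y, ℂ), f * f = f ∧
      ∑ i ∈ Finset.range a, (inducedAut τ)^[i] f = 1 := by
  classical
  obtain ⟨a, P, ha, -, hcard, hclopen, hdisj, hcover, -, hmaps, htrans⟩ := h
  -- Only the first nontrivial partition is needed; `f` will be the indicator function of one of its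
  -- members.
  replace hcard : (P 1).ncard = a 0 := by simpa using hcard 1
  have hg : ∀ i, ∀ C ∈ P 1, (Set.image τ)^[i] C ∈ P 1 := fun i C hC => by
    induction i with
    | zero => exact hC
    | succ i ih => rw [Function.iterate_succ_apply']; exact hmaps 1 _ ih
  have hg' : ∀ i C, (Set.image τ)^[i] C = τ^[i] '' C := fun i C =>
    congrFun (Set.image_iterate_eq (f := τ) (n := i)).symm C
  obtain ⟨B, hB⟩ : (P 1).Nonempty := by
    refine Set.nonempty_of_ncard_ne_zero ?_
    rw [hcard]
    linarith [ha 0]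
  have hunique : ∀ y, ∃ i < a 0, ∀ k < a 0, τ^[k] y ∈ B ↔ k = i := by
    intro y
    obtain ⟨C, hC, hy⟩ : y ∈ ⋃₀ P 1 := hcover 1 ▸ Set.mem_univ y
    -- Transitivity leads from `τ '' C` back to `C`, so `C` is periodic. Its orbit is all of `P 1`,
    -- which forces its minimal period to be `a 0`; hence an orbit segment of that length meets `B`
    -- exactly once.
    have hper : 0 < Function.minimalPeriod (Set.image τ) C := by
      obtain ⟨k, hk⟩ := htrans 1 _ (hmaps 1 C hC) C hC
      refine Function.IsPeriodicPt.minimalPeriod_pos (n := k + 1) k.succ_pos ?_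
      rw [Function.IsPeriodicPt, Function.IsFixedPt, Function.iterate_succ_apply, hg', hk]
    have himage : (fun i => (Set.image τ)^[i] C) ''
        Set.Iio (Function.minimalPeriod (Set.image τ) C) = P 1 := by
      ext D
      constructor
      · rintro ⟨i, -, rfl⟩
        exact hg i C hC
      · intro hD
        obtain ⟨k, hk⟩ := htrans 1 C hC D hD
        exact ⟨k % Function.minimalPeriod (Set.image τ) C, Nat.mod_lt _ hper,
          Function.iterate_mod_minimalPeriod_eq.trans ((hg' k C).trans hk)⟩
    have hinj := Function.iterate_injOn_Iio_minimalPeriod (f := Set.image τ) (x := C)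
    have hmin : Function.minimalPeriod (Set.image τ) C = a 0 := by
      rw [← hcard, ← himage, hinj.ncard_image, ← Nat.card_coe_set_eq]
      simp
    rw [hmin] at himage hinj
    obtain ⟨i, hi, hiB⟩ := himage.symm ▸ hB
    refine ⟨i, hi, fun k hk => ⟨fun hyB => hinj hk hi ?_, ?_⟩⟩
    · have hmem : τ^[k] y ∈ (Set.image τ)^[k] C := by
        rw [hg']
        exact Set.mem_image_of_mem _ hy
      by_contra hne
      refine Set.disjoint_left.1 (hdisj 1 (hg k C hC) hB fun h => hne ?_) hmem hyB
      exact h.trans hiB.symm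
    · rintro rfl
      rw [← hiB]
      simp only [hg']
      exact Set.mem_image_of_mem _ hy
  let f : C(Y, ℂ) := ⟨Set.indicator B 1, by
    exact (hclopen 1 B hB).1.continuous_indicator continuous_const⟩
  have hf : ∀ y, f y = if y ∈ B then 1 else 0 := fun y => rfl
  refine ⟨a 0, ha 0, f, ?_, ?_⟩
  · ext y
    simp [hf]
  · ext y
    obtain ⟨i, hi, h⟩ := hunique y
    rw [ContinuousMap.sum_apply, ContinuousMap.one_apply,
      Finset.sum_eq_single_of_mem i (Finset.mem_range.2 hi), inducedAut_iterate, hf,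
      if_pos ((h i hi).2 rfl)]
    intro k hk hki
    rw [inducedAut_iterate, hf, if_neg (mt (h k (Finset.mem_range.1 hk)).1 hki)]

/-! ### No cyclic idempotents in the ultraproduct -/

theorem familyMap_iterate {ι : Type*} {A : ι → Type*} [∀ i, CommCStarAlgebra (A i)]
    [∀ i, Nontrivial (A i)] (σ : ∀ i, A i ≃⋆ₐ[ℂ] A i) (f : lp A ∞) (k : ℕ) (i : ι) :
    (familyMap σ)^[k] f i = (σ i)^[k] (f i) := by
  induction k generalizing f with
  | zero => rfl
  | succ k ih => rw [Function.iterate_succ_apply, ih, Function.iterate_succ_apply]; rfl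

theorem ultraAut_iterate_mk {ι : Type*} (U : Ultrafilter ι) {A : ι → Type}
    [∀ i, CommCStarAlgebra (A i)] [∀ i, Nontrivial (A i)] (σ : ∀ i, A i ≃⋆ₐ[ℂ] A i) (f : lp A ∞)
    (k : ℕ) :
    (ultraAut U σ)^[k] (Ultraproduct.mk U A f) = Ultraproduct.mk U A ((familyMap σ)^[k] f) := by
  induction k generalizing f with
  | zero => rfl
  | succ k ih => rw [Function.iterate_succ_apply, ultraAut_mk, ih, Function.iterate_succ_apply]

/-- Only finitely many primes divide `a`, and a nonprincipal ultrafilter contains no finite set. -/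
theorem eventually_coprime {U : Ultrafilter Nat.Primes} (hU : ∀ p, U ≠ pure p) {a : ℕ}
    (ha : 0 < a) : ∀ᶠ p : Nat.Primes in (U : Filter Nat.Primes), Nat.Coprime p a := by
  by_contra h
  rw [← Ultrafilter.eventually_not] at h
  have hfin : {p : Nat.Primes | ¬ Nat.Coprime p a}.Finite := by
    refine Set.Finite.of_finite_image (f := fun p : Nat.Primes => (p : ℕ))
      ((Set.finite_Iic a).subset ?_) Nat.Primes.coe_nat_injective.injOn
    rintro _ ⟨p, hp, rfl⟩
    exact Nat.le_of_dvd ha (not_not.1 (mt (Nat.Prime.coprime_iff_not_dvd p.2).2 hp))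
  obtain ⟨p, -, hp⟩ := Ultrafilter.eq_pure_of_finite_mem hfin h
  exact hU p hp

/-- The ultraproduct of the `p`-adic odometers contains no idempotent whose translates over a cycle
of length at least `2` sum up to one. -/
theorem primeUltraAut_no_idempotent {U : Ultrafilter Nat.Primes} (hU : ∀ p, U ≠ pure p) {a : ℕ}
    (ha : 2 ≤ a) (g : Ultraproduct U fun p : Nat.Primes => C(ℕ → Fin (p : ℕ), ℂ))
    (hg : g * g = g) (hsum : ∑ i ∈ Finset.range a, (primeUltraAut U)^[i] g = 1) : False := by
  obtain ⟨f, rfl⟩ := Ultraproduct.mk_surjective U g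
  have h1 : f * f - f ∈ nullIdeal U _ := by
    refine Ideal.Quotient.eq_zero_iff_mem.1 ?_
    change Ultraproduct.mk U _ (f * f - f) = 0
    rw [map_sub, map_mul, hg, sub_self]
  have h2 : ∑ i ∈ Finset.range a, (familyMap fun p : Nat.Primes => pOdometerAut p)^[i] f - 1 ∈
      nullIdeal U _ := by
    refine Ideal.Quotient.eq_zero_iff_mem.1 ?_
    change Ultraproduct.mk U _ (_ - 1) = 0
    rw [map_sub, map_one, map_sum, ← hsum, sub_eq_zero]
    exact Finset.sum_congr rfl fun i _ => (ultraAut_iterate_mk U _ f i).symm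
  have ha' : (0 : ℝ) < 8 * a := by positivity
  -- Each condition holds `U`-almost everywhere, so a single prime satisfies all three, with the
  -- tolerance `1 / (8 * a)` that rounding requires.
  obtain ⟨p, hpa, hp1, hp2⟩ := ((eventually_coprime hU (by omega : 0 < a)).and
    (((mem_nullIdeal_iff U).1 h1 _ (inv_pos.2 ha')).and
      ((mem_nullIdeal_iff U).1 h2 _ (inv_pos.2 ha')))).exists
  refine pOdometer_not_approx_partition p.2.pos ha hpa (inv_mul_cancel₀ ha'.ne') (f p) hp1.le ?_
  refine le_trans (le_of_eq ?_) hp2.le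
  congr 1
  rw [lp.coeFn_sub, Pi.sub_apply, lp.coeFn_sum, Finset.sum_apply]
  congr 1
  exact Finset.sum_congr rfl fun i _ => 
    (familyMap_iterate (fun p : Nat.Primes => pOdometerAut p) f i p).symm

/-- A cyclic idempotent of `C(Y)` is carried into the ultraproduct by `j ∘ Φ⁻¹`, a homomorphism that
intertwines the automorphisms. -/
theorem not_hasOdometerPartitions {U : Ultrafilter Nat.Primes} (hU : ∀ p, U ≠ pure p) {A₀ : Type}
    [CommCStarAlgebra A₀] {σ₀ : A₀ ≃⋆ₐ[ℂ] A₀}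
    {j : A₀ →⋆ₐ[ℂ] Ultraproduct U fun p : Nat.Primes => C(ℕ → Fin (p : ℕ), ℂ)}
    (hj : IsElementaryEmbedding σ₀ (primeUltraAut U) j) {Y : Type} [TopologicalSpace Y]
    [CompactSpace Y] {τ : Y ≃ₜ Y} (hτ : Isomorphic σ₀ (inducedAut τ)) :
    ¬ HasOdometerPartitions τ := by
  intro h
  obtain ⟨a, ha, f, hf, hsum⟩ := h.exists_idempotent
  obtain ⟨Φ, hΦ⟩ := hτ
  have hsemi : Function.Semiconj (fun x => j (Φ.symm x)) (inducedAut τ) (primeUltraAut U) :=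
    fun x => by
      refine Eq.trans (congrArg j ?_) (hj.map_aut _)
      rw [StarAlgEquiv.symm_apply_eq, hΦ, StarAlgEquiv.apply_symm_apply]
  refine primeUltraAut_no_idempotent hU ha (j (Φ.symm f)) (by rw [← map_mul, ← map_mul, hf]) ?_
  rw [← map_one j, ← map_one Φ.symm, ← hsum, map_sum, map_sum]
  exact Finset.sum_congr rfl fun i _ => ((hsemi.iterate_right i).eq f).symm

/-! ### Products of finite discrete spaces are Cantor sets -/

/-- The Cantor space decomposes into `p` copies of itself in such a way that the copy and the first
`n` coordinates within the copy determine the first `n + s` coordinates. -/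
def IsDecomposition (p s : ℕ) (d : (ℕ → Bool) → Fin p) (t : (ℕ → Bool) → ℕ → Bool) : Prop :=
  Continuous d ∧ Continuous t ∧ (∀ i c, ∃ x, d x = i ∧ t x = c) ∧
    ∀ x y n, d x = d y → (∀ i < n, t x i = t y i) → ∀ i < n + s, x i = y i

theorem continuous_bool_rec {X Z : Type*} [TopologicalSpace X] [TopologicalSpace Z] {b : X → Bool}
    (hb : Continuous b) {f g : X → Z} (hf : Continuous f) (hg : Continuous g) :
    Continuous fun x => if b x then f x else g x := by
  refine continuous_if (fun x hx => ?_) hf.continuousOn hg.continuousOn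
  have hclopen : IsClopen {x | b x = true} := (isClopen_discrete {true}).preimage hb
  rw [hclopen.frontier_eq] at hx
  exact hx.elim

/-- If the first bit is `true`, the rest of the sequence is the new copy; otherwise the rest is
decomposed into the old `p` copies. At least one bit is consumed in either case, which is why the
gain rises from `0` to `1`. -/
theorem IsDecomposition.succ {p : ℕ} {d : (ℕ → Bool) → Fin p} {t : (ℕ → Bool) → ℕ → Bool}
    (h : IsDecomposition p 0 d t) :
    IsDecomposition (p + 1) 1
      (fun x => if x 0 then 0 else (d fun n => x (n + 1)).succ)
      (fun x => if x 0 then fun n => x (n + 1) else t fun n => x (n + 1)) := by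
  obtain ⟨hd, ht, hsurj, hinj⟩ := h
  have htail : Continuous fun (x : ℕ → Bool) n => x (n + 1) := by fun_prop
  refine ⟨continuous_bool_rec (continuous_apply 0) continuous_const
      ((continuous_of_discreteTopology (f := Fin.succ)).comp (hd.comp htail)),
    continuous_bool_rec (continuous_apply 0) htail (ht.comp htail), fun i c => ?_,
    fun x y n hdxy htxy => ?_⟩
  · refine Fin.cases ?_ (fun i => ?_) i
    · exact ⟨fun n => n.casesOn true c, by simp, by simp⟩
    · obtain ⟨x, rfl, rfl⟩ := hsurj i c
      exact ⟨fun n => n.casesOn false x, by simp, by simp⟩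
  · have h0 : x 0 = y 0 := by
      by_contra hne
      cases hx : x 0 <;> cases hy : y 0 <;> simp [hx, hy] at hdxy hne
      exact Fin.succ_ne_zero _ hdxy.symm
    intro i hi
    cases i with
    | zero => exact h0
    | succ i =>
      cases hx : x 0
      · simp only [← h0, hx, Bool.false_eq_true, if_false, Fin.succ_inj] at hdxy htxy
        exact hinj _ _ n hdxy htxy i (by omega)
      · simp only [← h0, hx, if_true] at htxy
        exact htxy i (by omega)

theorem exists_isDecomposition {p : ℕ} (hp : 2 ≤ p) : ∃ d t, IsDecomposition p 1 d t := by
  induction p, hp using Nat.le_induction with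
  | base =>
    -- The trivial decomposition into one copy consumes no bit, so the gain is `0` for `p = 1` and
    -- becomes `1` only from `p = 2` on.
    refine ⟨_, _, IsDecomposition.succ (p := 1) (d := fun _ => 0) (t := id)
      ⟨continuous_const, continuous_id, fun i c => ⟨c, Subsingleton.elim _ _, rfl⟩,
        fun x y n _ h => h⟩⟩
  | succ p _ ih =>
    obtain ⟨d, t, hd, ht, hsurj, hinj⟩ := ih
    exact ⟨_, _, IsDecomposition.succ ⟨hd, ht, hsurj, fun x y n h h' i hi =>
      hinj x y n h h' i (by omega)⟩⟩

/-- The homeomorphism is the itinerary map `x ↦ (d (t^n x))ₙ`. Every digit determines at least one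
further bit, which gives injectivity. Every finite itinerary occurs, so the image is dense; being
compact, it is everything. -/
theorem isCantorSet_pi_fin {p : ℕ} (hp : 2 ≤ p) : IsCantorSet (ℕ → Fin p) := by
  obtain ⟨d, t, hd, ht, hsurj, hinj⟩ := exists_isDecomposition hp
  let G : (ℕ → Bool) → ℕ → Fin p := fun x n => d (t^[n] x)
  have hG : Continuous G := continuous_pi fun n => hd.comp (ht.iterate n)
  have hagree : ∀ n x y, G x = G y → ∀ i < n, x i = y i := by
    intro n
    induction n with
    | zero => simp
    | succ n ih =>
      intro x y h
      exact hinj x y n (congrFun h 0) (ih _ _ (funext fun k => congrFun h (k + 1)))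
  have hGinj : Function.Injective G := fun x y h =>
    funext fun n => hagree (n + 1) x y h n n.lt_succ_self
  have happrox : ∀ n (y : ℕ → Fin p), ∃ x, ∀ i < n, G x i = y i := by
    intro n
    induction n with
    | zero => exact fun y => ⟨fun _ => true, by simp⟩
    | succ n ih =>
      intro y
      obtain ⟨c, hc⟩ := ih fun k => y (k + 1)
      obtain ⟨x, hx, rfl⟩ := hsurj (y 0) c
      refine ⟨x, fun i hi => ?_⟩
      cases i with
      | zero => exact hx
      | succ i => exact hc i (by omega)
  have hGsurj : Function.Surjective G := by
    intro y
    have hclosed : IsClosed (Set.range G) := (isCompact_range hG).isClosed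
    rw [← Set.mem_range, ← hclosed.closure_eq]
    choose x hx using fun n => happrox n y
    refine mem_closure_of_tendsto (f := fun n => G (x n)) (b := Filter.atTop)
      (tendsto_pi_nhds.2 fun k => tendsto_nhds_of_eventually_eq ?_) (.of_forall fun n => ⟨_, rfl⟩)
    filter_upwards [Filter.eventually_gt_atTop k] with n hn
    exact hx n k hn
  exact ⟨(Continuous.homeoOfEquivCompactToT2 (f := Equiv.ofBijective G ⟨hGinj, hGsurj⟩) hG).symm⟩

/-! ### Odometers are not separably axiomatizable -/

theorem pOdometer_isOdometer {p : ℕ} (hp : 2 ≤ p) :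
    IsOdometer (ℕ → Fin p) (odometer fun _ => p) :=
  ⟨fun _ => p, fun _ => hp, Homeomorph.refl _, fun _ => rfl⟩

theorem not_separablyAxiomatizable : ¬ SeparablyAxiomatizable IsCantorSet IsOdometer := by
  rintro ⟨T, hT⟩
  -- Any nonprincipal ultrafilter on the primes would do.
  have hU : ∀ p : Nat.Primes, Filter.hyperfilter Nat.Primes ≠ pure p := fun p h =>
    Filter.notMem_hyperfilter_of_finite (Set.finite_singleton p)
      (h ▸ Ultrafilter.mem_pure.2 (Set.mem_singleton p))
  have hmodels : ∀ p : Nat.Primes, Models (pOdometerAut p) T := fun p =>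
    (hT _ _).2 ⟨ℕ → Fin (p : ℕ), inferInstance, inferInstance, inferInstance, _,
      isCantorSet_pi_fin p.2.two_le, pOdometer_isOdometer p.2.two_le,
      StarAlgEquiv.refl ℂ _, fun _ => rfl⟩
  obtain ⟨A₀, _, _, σ₀, j, hj⟩ :=
    exists_separable_elementary_substructure (primeUltraAut (Filter.hyperfilter Nat.Primes))
  obtain ⟨X, _, _, _, S, -, hS, hiso⟩ :=
    (hT A₀ σ₀).1 (hj.models (Models.ultraproduct _ _ hmodels))
  exact not_hasOdometerPartitions hU hj hiso hS.hasOdometerPartitions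

end CStarDyn

end

theorem theorem2p6 :
    ¬ CStarDyn.SeparablyAxiomatizable CStarDyn.IsCantorSet CStarDyn.IsOdometer ∧
    ∀ U : Ultrafilter Nat.Primes, (∀ p, U ≠ pure p) →
      (∃ (A₀ : Type) (_ : CommCStarAlgebra A₀) (_ : TopologicalSpace.SeparableSpace A₀)
        (σ₀ : A₀ ≃⋆ₐ[ℂ] A₀)
        (j : A₀ →⋆ₐ[ℂ] CStarDyn.Ultraproduct U fun p : Nat.Primes => C(ℕ → Fin (p : ℕ), ℂ)),
        CStarDyn.IsElementaryEmbedding σ₀ (CStarDyn.primeUltraAut U) j) ∧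
      ∀ (A₀ : Type) [CommCStarAlgebra A₀] [TopologicalSpace.SeparableSpace A₀]
        (σ₀ : A₀ ≃⋆ₐ[ℂ] A₀)
        (j : A₀ →⋆ₐ[ℂ] CStarDyn.Ultraproduct U fun p : Nat.Primes => C(ℕ → Fin (p : ℕ), ℂ)),
        CStarDyn.IsElementaryEmbedding σ₀ (CStarDyn.primeUltraAut U) j →
        (∀ T : CStarDyn.Theory, (∀ p : Nat.Primes, CStarDyn.Models (CStarDyn.pOdometerAut p) T) →
          CStarDyn.Models σ₀ T) ∧
        ∀ (Y : Type) [TopologicalSpace Y] [CompactSpace Y] [T2Space Y] (τ : Y ≃ₜ Y),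
          CStarDyn.Isomorphic σ₀ (CStarDyn.inducedAut τ) →
          ¬ CStarDyn.HasOdometerPartitions τ :=
  ⟨CStarDyn.not_separablyAxiomatizable, fun U hU =>
    ⟨CStarDyn.exists_separable_elementary_substructure _, fun _ _ _ _ _ hj =>
      ⟨fun _ hT => hj.models (CStarDyn.Models.ultraproduct U _ hT),
        fun _ _ _ _ _ hτ => CStarDyn.not_hasOdometerPartitions hU hj hτ⟩⟩⟩
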